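/- **Definitions.** A *polytope* in $\mathbb{R}^m$ is a nonempty finite union of relative interiors of convex polytopes (it need not be convex, full-dimensional or closed). The *rank* of a point of $\mathbb{R}^m$ is the sum of its coordinates, and the rank of a polytope $P$ is the sum of the maximum and the minimum (supremum and infimum, if $P$ is not closed) of the ranks of its points. A *partial simplex* is a simplex from which the relative interiors of some of its proper faces have been removed. A *swipe* $S$ is given by a coordinate direction $e_i$ and two partial simplices $S^s$, $S^e$ (its starting and ending *turning sets*) such that translation by non-negative multiples of $e_i$, $x \mapsto x+\lambda(x)e_i$ with $\lambda\ge 0$ affine, maps $S^s$ bijectively onto $S^e$; as a set, $S$ is the union of the segments joining corresponding points. A sequence of swipes $S_0,\dots,S_k$ ($k \ge 0$) is *compatible* if $S_i^e=S_{i+1}^s$ for $0\le i<k$. A *real snake* is the union of a compatible sequence $S_0,\dots,S_k$ of swipes such that whenever $i<j$ and $x\in S_i\cap S_j$, we have $x\in S_i^e$, $x\in S_j^s$, and $x\in S_l^s\cap S_l^e$ for all $i<l<j$. A point $x \in S_i$ is *$i$-halted* if either $x\in S_i^s$ and $x\in S_l^s\cap S_l^e$ for all $l<i$, or $x\in S_i^e$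 and $x\in S_l^s\cap S_l^e$ for all $l>i$. A *fake snake* is the union of the sets $T_i=S_i\setminus\{i\text{-halted points}\}$ for a compatible sequence $S_0,\dots,S_k$ such that whenever $i<j$ and $x\in T_i\cap T_j$, we have $x\in T_i \cap S_i^e$, $x\in T_j \cap S_j^s$, and $x\in T_l\cap S_l^s\cap S_l^e$ for all $i<l<j$. A snake contained in $P$ is *symmetric* if for every vertex $v$ of the closure of $S_0^s$, with corresponding vertex $v'$ of the closure of $S_k^e$ (the image of $v$ under the successive affine translation maps), the sum of the ranks of $v$ and $v'$ is the rank of $P$. A *geometric symmetric chain decomposition* of $P$ is a partition of $P$ into finitely many symmetric snakes. It satisfies the *strong hyperplane condition* if for each swipe occurring in it, of direction $e_i$ say, and each of the two turning sets of that swipe, some hyperplane containing the turning set has the form $\sum_j a_jx_j=b$ with all $a_j$ integers, $b$ rational, and $a_i=\pm1$. **Theorem 6.8.** Let $P\subset\mathbb{R}^m$ and $Q\subset\mathbb{R}^n$ be polytopes with given geometric symmetric chain decompositions that satisfy the strong hyperplane condition. Suppose that all snakes in the two decompositions are real, or that all snakes in the two decompositions are fake. Then the product $P\times Q\subset\mathbb{R}^{m+n}$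 has a geometric symmetric chain decomposition that satisfies the strong hyperplane condition. -/

import Mathlib

namespace SnakeDecomposition

/-- The rank of a point of `ℝ^ι`: the sum of its coordinates. -/
def rank {ι : Type*} [Fintype ι] (x : ι → ℝ) : ℝ := ∑ i, x i

/-- The set of all convex combinations of the points of `s` with strictly positive weights, i.e. the
relative interior of the convex hull of `s`. It is empty when `s` is empty. -/
def openHull {ι : Type*} (s : Finset (ι → ℝ)) : Set (ι → ℝ) :=
  {x | ∃ w : (ι → ℝ) → ℝ, (∀ p ∈ s, 0 < w p) ∧ ∑ p ∈ s, w p = 1 ∧ ∑ p ∈ s, w p • p = x}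

/-- Polytopes, not necessarily convex, full-dimensional or closed: nonempty finite unions of relative
interiors of convex polytopes. A convex polytope is the union of the relative interiors of its
faces, so all finite unions of convex polytopes are included, and also the sets obtained from
these by leaving out some open faces. -/
def IsPolytope {ι : Type*} (P : Set (ι → ℝ)) : Prop :=
  P.Nonempty ∧ ∃ F : Set (Finset (ι → ℝ)), F.Finite ∧ P = ⋃ s ∈ F, openHull s

/-- The rank of a polytope: the sum of the maximum and the minimum of the rank of its points
(of the supremum and the infimum, if the polytope is not closed). -/
noncomputable def polytopeRank {ι : Type*} [Fintype ι] (P : Set (ι → ℝ)) : ℝ :=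
  sSup (rank '' P) + sInf (rank '' P)

/-- A partial simplex: a simplex, given by its affinely independent vertices, together with a set of
proper faces (given by their vertices) whose relative interiors are removed. -/
structure PartialSimplex (ι : Type*) where
  vertices : Finset (ι → ℝ)
  nonempty : vertices.Nonempty
  indep : AffineIndependent ℝ ((↑) : vertices → (ι → ℝ))
  removed : Set (Finset (ι → ℝ))
  removed_ssubset : ∀ t ∈ removed, t ⊂ vertices

/-- The points of a partial simplex. -/
def PartialSimplex.carrier {ι : Type*} (A : PartialSimplex ι) : Set (ι → ℝ) :=
  convexHull ℝ (A.vertices : Set (ι → ℝ)) \ ⋃ t ∈ A.removed, openHull t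

/-- A swipe in the coordinate direction `dir`: two partial simplices such that translating each
point `x` of the first one by the nonnegative multiple `shift x` of the basis vector gives a
bijection onto the second one. The bijection is a shear, i.e. `shift` is affine; if the
two turning sets are transversal to the direction (as they are under the strong hyperplane
condition), then every bijection by translations along the direction is of this form. -/
structure Swipe (ι : Type*) [DecidableEq ι] where
  dir : ι
  starting : PartialSimplex ι
  ending : PartialSimplex ι
  shift : (ι → ℝ) →ᵃ[ℝ] ℝ
  shift_nonneg : ∀ x ∈ starting.carrier, 0 ≤ shift x
  bijOn : Set.BijOn (fun x => x + shift x • (Pi.single dir 1 : ι → ℝ))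
    starting.carrier ending.carrier

/-- The map from the starting to the ending turning set. -/
def Swipe.move {ι : Type*} [DecidableEq ι] (S : Swipe ι) (x : ι → ℝ) : ι → ℝ :=
  x + S.shift x • (Pi.single S.dir 1 : ι → ℝ)

/-- The points of a swipe: the union of the segments that join corresponding points of the two
turning sets. -/
def Swipe.carrier {ι : Type*} [DecidableEq ι] (S : Swipe ι) : Set (ι → ℝ) :=
  ⋃ x ∈ S.starting.carrier, segment ℝ x (S.move x)

/-- A compatible sequence of swipes `S₀, …, S_len`. -/
structure CompatibleSeq (ι : Type*) [DecidableEq ι] where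
  len : ℕ
  swipe : Fin (len + 1) → Swipe ι
  compatible : ∀ i : Fin len,
    (swipe i.castSucc).ending.carrier = (swipe i.succ).starting.carrier

/-- The non self-intersecting condition of real snakes. -/
def CompatibleSeq.RealCondition {ι : Type*} [DecidableEq ι] (c : CompatibleSeq ι) : Prop :=
  ∀ i j, i < j → ∀ x, x ∈ (c.swipe i).carrier → x ∈ (c.swipe j).carrier →
    x ∈ (c.swipe i).ending.carrier ∧ x ∈ (c.swipe j).starting.carrier ∧
    ∀ k, i < k → k < j →
      x ∈ (c.swipe k).starting.carrier ∧ x ∈ (c.swipe k).ending.carrier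

/-- The point `x` is `i`-halted. -/
def CompatibleSeq.Halted {ι : Type*} [DecidableEq ι] (c : CompatibleSeq ι)
    (i : Fin (c.len + 1)) (x : ι → ℝ) : Prop :=
  (x ∈ (c.swipe i).starting.carrier ∧
    ∀ k, k < i → x ∈ (c.swipe k).starting.carrier ∧ x ∈ (c.swipe k).ending.carrier) ∨
  (x ∈ (c.swipe i).ending.carrier ∧
    ∀ k, i < k → x ∈ (c.swipe k).starting.carrier ∧ x ∈ (c.swipe k).ending.carrier)

/-- The `i`-th swipe without its `i`-halted points. -/
def CompatibleSeq.trimmed {ι : Type*} [DecidableEq ι] (c : CompatibleSeq ι)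
    (i : Fin (c.len + 1)) : Set (ι → ℝ) :=
  (c.swipe i).carrier \ {x | c.Halted i x}

/-- The non self-intersecting condition of fake snakes. -/
def CompatibleSeq.FakeCondition {ι : Type*} [DecidableEq ι] (c : CompatibleSeq ι) : Prop :=
  ∀ i j, i < j → ∀ x, x ∈ c.trimmed i → x ∈ c.trimmed j →
    x ∈ c.trimmed i ∩ (c.swipe i).ending.carrier ∧
    x ∈ c.trimmed j ∩ (c.swipe j).starting.carrier ∧
    ∀ k, i < k → k < j →
      x ∈ c.trimmed k ∩ (c.swipe k).starting.carrier ∧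
      x ∈ c.trimmed k ∩ (c.swipe k).ending.carrier

/-- Snakes: real ones and fake ones. -/
inductive Snake (ι : Type*) [DecidableEq ι] where
  | real (c : CompatibleSeq ι) (h : c.RealCondition) : Snake ι
  | fake (c : CompatibleSeq ι) (h : c.FakeCondition) : Snake ι

/-- The underlying sequence of swipes of a snake. -/
def Snake.seq {ι : Type*} [DecidableEq ι] : Snake ι → CompatibleSeq ι
  | .real c _ => c
  | .fake c _ => c

/-- The points of a snake. -/
def Snake.carrier {ι : Type*} [DecidableEq ι] : Snake ι → Set (ι → ℝ)
  | .real c _ => ⋃ i, (c.swipe i).carrier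
  | .fake c _ => ⋃ i, c.trimmed i

def Snake.IsReal {ι : Type*} [DecidableEq ι] : Snake ι → Prop
  | .real _ _ => True
  | .fake _ _ => False

def Snake.IsFake {ι : Type*} [DecidableEq ι] : Snake ι → Prop
  | .real _ _ => False
  | .fake _ _ => True

/-- A snake is symmetric in `P` if the ranks of each vertex of the closure of `S₀ˢ` and of the
corresponding vertex of the closure of the last ending set add up to the rank of `P`. Here
`p 0, p 1, …` are the successive images of the vertex `p 0` under the shears of the swipes. -/
def Snake.IsSymmetric {ι : Type*} [Fintype ι] [DecidableEq ι] (S : Snake ι)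
    (P : Set (ι → ℝ)) : Prop :=
  ∀ p : Fin (S.seq.len + 1 + 1) → (ι → ℝ),
    p 0 ∈ (S.seq.swipe 0).starting.vertices →
    (∀ i : Fin (S.seq.len + 1), p i.succ = (S.seq.swipe i).move (p i.castSucc)) →
    rank (p 0) + rank (p (Fin.last (S.seq.len + 1))) = polytopeRank P

/-- A geometric symmetric chain decomposition of `P`: a partition of `P` into finitely many
symmetric snakes. -/
structure GeometricSCD {ι : Type*} [Fintype ι] [DecidableEq ι] (P : Set (ι → ℝ)) where
  size : ℕ
  snake : Fin size → Snake ι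
  disjoint : ∀ i j, i ≠ j → Disjoint (snake i).carrier (snake j).carrier
  union_eq : ⋃ i, (snake i).carrier = P
  symmetric : ∀ i, (snake i).IsSymmetric P

/-- The set `T` lies in a hyperplane `∑ aⱼ xⱼ = b` with all `aⱼ` integers, `b` rational, and
`a_d = ±1`. -/
def InIntegralHyperplane {ι : Type*} [Fintype ι] (T : Set (ι → ℝ)) (d : ι) : Prop :=
  ∃ (a : ι → ℤ) (b : ℚ), (a d = 1 ∨ a d = -1) ∧ ∀ x ∈ T, ∑ j, (a j : ℝ) * x j = (b : ℝ)

/-- The strong hyperplane condition: each of the two turning sets of each swipe lies in an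
integral hyperplane for the direction of the swipe. -/
def GeometricSCD.StrongHyperplaneCondition {ι : Type*} [Fintype ι] [DecidableEq ι]
    {P : Set (ι → ℝ)} (D : GeometricSCD P) : Prop :=
  ∀ (n : Fin D.size) (i : Fin ((D.snake n).seq.len + 1)),
    InIntegralHyperplane ((D.snake n).seq.swipe i).starting.carrier
      ((D.snake n).seq.swipe i).dir ∧
    InIntegralHyperplane ((D.snake n).seq.swipe i).ending.carrier
      ((D.snake n).seq.swipe i).dir

def GeometricSCD.AllReal {ι : Type*} [Fintype ι] [DecidableEq ι]
    {P : Set (ι → ℝ)} (D : GeometricSCD P) : Prop :=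
  ∀ n, (D.snake n).IsReal

def GeometricSCD.AllFake {ι : Type*} [Fintype ι] [DecidableEq ι]
    {P : Set (ι → ℝ)} (D : GeometricSCD P) : Prop :=
  ∀ n, (D.snake n).IsFake

/-- The product `P × Q` as a subset of `ℝ^ι × ℝ^κ = ℝ^(ι ⊕ κ)`. -/
def product {ι κ : Type*} (P : Set (ι → ℝ)) (Q : Set (κ → ℝ)) : Set (ι ⊕ κ → ℝ) :=
  {z | (fun i => z (Sum.inl i)) ∈ P ∧ (fun j => z (Sum.inr j)) ∈ Q}

end SnakeDecomposition

/-! A snake is a family of monotone lattice-direction paths, one for each point `v` of its first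
turning set: `v` is carried along by the successive shears. The strong hyperplane condition makes
the projection along the swipe direction onto the hyperplane of a turning set an affine map with
integral linear part, so the turning points of a path are integral affine functions of `v`, and `v`
is an integral affine function of any point of a given segment. The non self-intersecting conditions
then amount to this: a point of a real snake lies on the path of only one `v`, and a fake snake
consists of the paths without their end points, again each point lying on only one path. So the
decomposition partitions `P` into symmetric paths, all with end points or all without
(`exists_follows`, `halted_iff`, `exists_isSweep`).

The product of two paths is cut into hooks as in the classical chain decomposition of a product of
two chains. The hook with parameter `(a, b, t)` starts at the pair formed by the start of the path
of `a` and the point at distance `t` from the start of the path of `b`; it follows `a` up to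
distance `t` from its end, then follows `b` to its end. The time `t` raises the rank of the start
and lowers that of the end, so symmetry is preserved. A pair `(x, y)` lies on the hook whose `t` is
the smaller of the distance of `y` from its start and that of `x` from its end, and on no other
(`hook_inside_iff`, `IsSweep.exists_product`). For paths without end points the strict bounds on `t`
make the hooks without end points fill exactly the product, which is why both factors must be of one
kind.

The swipes that make up a hook depend on the segments containing the two components of its corner.
This cuts the parameters `(a, b, t)` into finitely many regions given by affine inequalities, and a
common subdivision into relatively open simplices (`exists_isSimplexPartition_subordinate`) leaves
one combinatorial type on each part. An affine map with an affine left inverse carries an open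
simplex to an open simplex, so each part yields a snake (`exists_compatibleSeq`, `exists_snake`),
and integrality of the maps gives back the hyperplanes. -/

namespace SnakeDecomposition

/-! ### Integral affine maps and integral hyperplanes. -/

section IntAffine

variable {τ ι κ : Type*} [Fintype τ]

/-- Affine functions with integral linear part and rational constant term. -/
def IntAffine (f : (τ → ℝ) → ℝ) : Prop :=
  ∃ (a : τ → ℤ) (b : ℚ), ∀ x, f x = ∑ j, (a j : ℝ) * x j + b

/-- Maps all of whose coordinates are integral affine functions. -/
def IntAffineMap (f : (τ → ℝ) → (ι → ℝ)) : Prop :=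
  ∀ i, IntAffine fun x => f x i

theorem IntAffine.const (q : ℚ) : IntAffine fun _ : τ → ℝ => (q : ℝ) :=
  ⟨0, q, by simp⟩

theorem IntAffine.zero : IntAffine fun _ : τ → ℝ => (0 : ℝ) := ⟨0, 0, by simp⟩

theorem IntAffine.coord (i : τ) : IntAffine fun x : τ → ℝ => x i := by
  classical
  exact ⟨Pi.single i 1, 0, by simp [Pi.single_apply]⟩

theorem IntAffine.add {f g : (τ → ℝ) → ℝ} (hf : IntAffine f) (hg : IntAffine g) :
    IntAffine fun x => f x + g x := by
  obtain ⟨a, b, h⟩ := hf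
  obtain ⟨a', b', h'⟩ := hg
  refine ⟨a + a', b + b', fun x => ?_⟩
  simp only [h, h', Pi.add_apply, Int.cast_add, add_mul, Finset.sum_add_distrib, Rat.cast_add]
  ring

theorem IntAffine.int_mul {f : (τ → ℝ) → ℝ} (n : ℤ) (hf : IntAffine f) :
    IntAffine fun x => (n : ℝ) * f x := by
  obtain ⟨a, b, h⟩ := hf
  refine ⟨fun j => n * a j, n * b, fun x => ?_⟩
  simp only [h, mul_add, Finset.mul_sum, Int.cast_mul, Rat.cast_mul, Rat.cast_intCast, mul_assoc]

theorem IntAffine.neg {f : (τ → ℝ) → ℝ} (hf : IntAffine f) : IntAffine fun x => -f x := by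
  simpa using hf.int_mul (-1)

theorem IntAffine.sub {f g : (τ → ℝ) → ℝ} (hf : IntAffine f) (hg : IntAffine g) :
    IntAffine fun x => f x - g x := by
  simpa [sub_eq_add_neg] using hf.add hg.neg

theorem IntAffine.sum {α : Type*} (s : Finset α) {f : α → (τ → ℝ) → ℝ}
    (hf : ∀ i ∈ s, IntAffine (f i)) : IntAffine fun x => ∑ i ∈ s, f i x := by
  classical
  induction s using Finset.induction_on with
  | empty => simpa using IntAffine.zero
  | insert a s ha ih =>
    simp only [Finset.sum_insert ha]
    exact (hf a (by simp)).add (ih fun i hi => hf i (by simp [hi]))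

theorem IntAffine.comp [Fintype ι] {f : (ι → ℝ) → ℝ} {g : (τ → ℝ) → (ι → ℝ)} (hf : IntAffine f)
    (hg : IntAffineMap g) : IntAffine fun x => f (g x) := by
  obtain ⟨a, b, h⟩ := hf
  simp only [h]
  exact (IntAffine.sum _ fun i _ => (hg i).int_mul (a i)).add (IntAffine.const b)

theorem IntAffineMap.comp [Fintype ι] {f : (ι → ℝ) → (κ → ℝ)} {g : (τ → ℝ) → (ι → ℝ)} (hf : IntAffineMap f)
    (hg : IntAffineMap g) : IntAffineMap fun x => f (g x) :=
  fun i => (hf i).comp hg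

theorem IntAffineMap.id : IntAffineMap fun x : τ → ℝ => x := fun i => IntAffine.coord i

theorem IntAffine.rank : IntAffine (rank : (τ → ℝ) → ℝ) :=
  IntAffine.sum _ fun i _ => IntAffine.coord i

theorem IntAffineMap.rank [Fintype ι] {f : (τ → ℝ) → (ι → ℝ)} (hf : IntAffineMap f) :
    IntAffine fun x => SnakeDecomposition.rank (f x) :=
  IntAffine.rank.comp hf

theorem IntAffineMap.add_single [DecidableEq ι] {f : (τ → ℝ) → (ι → ℝ)} (hf : IntAffineMap f)
    {c : (τ → ℝ) → ℝ} (hc : IntAffine c) (d : ι) :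
    IntAffineMap fun x => f x + c x • (Pi.single d 1 : ι → ℝ) := by
  intro i
  by_cases h : i = d
  · subst h
    simpa using (hf i).add hc
  · simpa [h] using hf i

theorem IntAffineMap.sumElim {f : (τ → ℝ) → (ι → ℝ)} {g : (τ → ℝ) → (κ → ℝ)}
    (hf : IntAffineMap f) (hg : IntAffineMap g) :
    IntAffineMap fun x => (Sum.elim (f x) (g x) : ι ⊕ κ → ℝ) := by
  rintro (i | i)
  · exact hf i
  · exact hg i

theorem IntAffineMap.reindex (e : ι → τ) : IntAffineMap fun (x : τ → ℝ) i => x (e i) :=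
  fun i => IntAffine.coord (e i)

theorem IntAffine.exists_affineMap {f : (τ → ℝ) → ℝ} (hf : IntAffine f) :
    ∃ g : (τ → ℝ) →ᵃ[ℝ] ℝ, ∀ x, g x = f x := by
  obtain ⟨a, b, h⟩ := hf
  refine ⟨(∑ j, (a j : ℝ) • (LinearMap.proj j : (τ → ℝ) →ₗ[ℝ] ℝ)).toAffineMap +
    AffineMap.const ℝ _ (b : ℝ), fun x => ?_⟩
  simp [h]

theorem IntAffineMap.exists_affineMap {f : (τ → ℝ) → (ι → ℝ)} (hf : IntAffineMap f) :
    ∃ g : (τ → ℝ) →ᵃ[ℝ] (ι → ℝ), ∀ x, g x = f x := by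
  choose g hg using fun i => (hf i).exists_affineMap
  exact ⟨AffineMap.pi g, fun x => funext fun i => by simp [hg]⟩

theorem rank_add_single [Fintype ι] [DecidableEq ι] (x : ι → ℝ) (s : ℝ) (d : ι) :
    rank (x + s • (Pi.single d 1 : ι → ℝ)) = rank x + s := by
  simp [rank, Finset.sum_add_distrib, Pi.single_apply]

theorem rank_sumElim [Fintype ι] [Fintype κ] (x : ι → ℝ) (y : κ → ℝ) :
    rank (Sum.elim x y : ι ⊕ κ → ℝ) = rank x + rank y := by
  simp [rank]

/-- A set on which a coordinate is an integral affine function of the point, not depending on the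
coordinate itself, lies in an integral hyperplane. -/
theorem inIntegralHyperplane_of_intAffine [Fintype ι] [DecidableEq ι] {T : Set (ι → ℝ)} {d : ι}
    {f : (ι → ℝ) → ℝ} (hf : IntAffine f)
    (hd : ∀ x (s : ℝ), f (x + s • (Pi.single d 1 : ι → ℝ)) = f x) (h : ∀ x ∈ T, x d = f x) :
    InIntegralHyperplane T d := by
  obtain ⟨a, b, hab⟩ := hf
  -- Invariance along `d` kills the coefficient of `x d` in `f`, so `x d - f x` has coefficient 1
  -- there.
  have had : (a d : ℝ) = 0 := by
    have := hd 0 1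
    simpa [hab, Pi.single_apply] using this
  have had' : a d = 0 := by exact_mod_cast had
  refine ⟨Pi.single d 1 - a, b, Or.inl (by simp [had']), fun x hx => ?_⟩
  have h1 := h x hx
  rw [hab] at h1
  simp only [Pi.sub_apply, Int.cast_sub, sub_mul, Finset.sum_sub_distrib]
  have : ∑ j, (((Pi.single d 1 : ι → ℤ) j : ℤ) : ℝ) * x j = x d := by
    simp [Pi.single_apply]
  rw [this]
  linarith

/-- The projection along a coordinate direction onto an integral hyperplane. -/
theorem InIntegralHyperplane.exists_projection [Fintype ι] [DecidableEq ι] {T : Set (ι → ℝ)} {d : ι}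
    (hT : InIntegralHyperplane T d) :
    ∃ f : (ι → ℝ) → (ι → ℝ), IntAffineMap f ∧
      (∀ x (s : ℝ), f (x + s • (Pi.single d 1 : ι → ℝ)) = f x) ∧ ∀ x ∈ T, f x = x := by
  obtain ⟨a, b, had, h⟩ := hT
  -- The displacement to the hyperplane is the defect divided by `a d`; since `a d = ±1`, dividing
  -- is multiplying, and integrality survives.
  have hint : IntAffine fun x : ι → ℝ => (a d : ℝ) * (b - ∑ j, (a j : ℝ) * x j) :=
    IntAffine.int_mul (a d) ((IntAffine.const b).sub
      (IntAffine.sum _ fun j _ => (IntAffine.coord j).int_mul (a j)))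
  have hsq : (a d : ℝ) * (a d : ℝ) = 1 := by
    rcases had with h | h <;> simp [h]
  refine ⟨_, IntAffineMap.id.add_single hint d, fun x s => ?_, fun x hx => by simp [h x hx]⟩
  have : ∑ j, (a j : ℝ) * (x + s • (Pi.single d 1 : ι → ℝ)) j
      = ∑ j, (a j : ℝ) * x j + s * a d := by
    simp only [Pi.add_apply, mul_add, Finset.sum_add_distrib, Pi.smul_apply, Pi.single_apply]
    simp [mul_comm]
  rw [this, add_assoc, ← add_smul]
  congr 2
  linear_combination (-s) * hsq

end IntAffine

/-! ### Relative interiors of simplices and of their faces. -/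

section OpenHull

variable {ι κ : Type*}

theorem affineMap_sum_smul {E F : Type*} [AddCommGroup E] [Module ℝ E] [AddCommGroup F]
    [Module ℝ F] (f : E →ᵃ[ℝ] F) (s : Finset E) (w : E → ℝ) (hw : ∑ p ∈ s, w p = 1) :
    f (∑ p ∈ s, w p • p) = ∑ p ∈ s, w p • f p := by
  have h : ∀ x, f x = f.linear x + f 0 := fun x => congrFun f.decomp x
  have h' : ∀ p ∈ s, w p • f p = w p • f.linear p + w p • f 0 := fun p _ => by rw [h p, smul_add]
  rw [h, Finset.sum_congr rfl h', Finset.sum_add_distrib, ← Finset.sum_smul, hw, map_sum, one_smul]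
  simp

/-- Affine independence of a finite set of points in terms of weights. -/
theorem affineIndependent_finset_iff {E : Type*} [AddCommGroup E] [Module ℝ E] {s : Finset E} :
    AffineIndependent ℝ ((↑) : s → E) ↔ ∀ w : E → ℝ, ∑ p ∈ s, w p = 0 → ∑ p ∈ s, w p • p = 0 →
      ∀ p ∈ s, w p = 0 := by
  classical
  rw [affineIndependent_iff_of_fintype]
  constructor
  · intro h w h0 h1 p hp
    have h0' : ∑ i : s, w i = 0 := by rw [Finset.sum_coe_sort s w, h0]
    refine h (fun i => w i) h0' ?_ ⟨p, hp⟩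
    rw [Finset.weightedVSub_eq_linear_combination _ h0', ← h1]
    exact Finset.sum_coe_sort s fun p => w p • p
  · intro h w h0 h1 i
    rw [Finset.weightedVSub_eq_linear_combination _ h0] at h1
    have key := h (fun p => if hp : p ∈ s then w ⟨p, hp⟩ else 0) ?_ ?_ i i.2
    · simpa using key
    · rw [← Finset.sum_coe_sort s, ← h0]
      exact Finset.sum_congr rfl fun j _ => by simp
    · rw [← Finset.sum_coe_sort s (fun p => (if hp : p ∈ s then w ⟨p, hp⟩ else 0) • p), ← h1]
      exact Finset.sum_congr rfl fun j _ => by simp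

theorem openHull_subset_convexHull (s : Finset (ι → ℝ)) : openHull s ⊆ convexHull ℝ (s : Set _) := by
  rintro x ⟨w, hw, h1, rfl⟩
  rw [Finset.mem_convexHull']
  exact ⟨w, fun p hp => (hw p hp).le, h1, rfl⟩

/-- Dropping the points of weight zero leaves a subset on which all weights are positive. -/
theorem mem_convexHull_iff_exists_openHull {s : Finset (ι → ℝ)} {x : ι → ℝ} :
    x ∈ convexHull ℝ (s : Set (ι → ℝ)) ↔ ∃ t ⊆ s, x ∈ openHull t := by
  classical
  constructor
  · intro hx
    rw [Finset.mem_convexHull'] at hx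
    obtain ⟨w, hw, h1, rfl⟩ := hx
    refine ⟨s.filter fun p => 0 < w p, Finset.filter_subset _ _,
      w, fun p hp => (Finset.mem_filter.1 hp).2, ?_, ?_⟩
    · rw [← h1]
      refine Finset.sum_filter_of_ne fun p hp h => lt_of_le_of_ne (hw p hp) (Ne.symm h)
    · refine Finset.sum_filter_of_ne fun p hp h => lt_of_le_of_ne (hw p hp) (Ne.symm ?_)
      rintro h0
      simp [h0] at h
  · rintro ⟨t, ht, hx⟩
    exact convexHull_mono (Finset.coe_subset.2 ht) (openHull_subset_convexHull t hx)

theorem openHull_nonempty {s : Finset (ι → ℝ)} (hs : s.Nonempty) : (openHull s).Nonempty := by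
  have hc : (0 : ℝ) < s.card := by exact_mod_cast hs.card_pos
  exact ⟨_, fun _ => (s.card : ℝ)⁻¹, fun p _ => inv_pos.2 hc, by simp [hc.ne'], rfl⟩

theorem openHull_image [DecidableEq (κ → ℝ)] {s : Finset (ι → ℝ)} (f : (ι → ℝ) →ᵃ[ℝ] (κ → ℝ))
    (hf : Set.InjOn f s) : openHull (s.image f) = f '' openHull s := by
  ext x
  constructor
  · rintro ⟨w, hw, h1, rfl⟩
    rw [Finset.sum_image hf] at h1
    refine ⟨_, ⟨fun p => w (f p), fun p hp => hw _ (Finset.mem_image_of_mem _ hp), h1, rfl⟩, ?_⟩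
    rw [Finset.sum_image hf, affineMap_sum_smul f s (fun p => w (f p)) h1]
  · rintro ⟨_, ⟨w, hw, h1, rfl⟩, rfl⟩
    have hinv : ∀ p ∈ s, Function.invFunOn f s (f p) = p := fun p hp =>
      hf.leftInvOn_invFunOn hp
    refine ⟨fun q => w (Function.invFunOn f s q), fun q hq => ?_, ?_, ?_⟩
    · obtain ⟨p, hp, rfl⟩ := Finset.mem_image.1 hq
      simpa [hinv p hp] using hw p hp
    · rw [Finset.sum_image hf, ← h1]
      exact Finset.sum_congr rfl fun p hp => by rw [hinv p hp]
    · rw [Finset.sum_image hf, affineMap_sum_smul f s w h1]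
      exact Finset.sum_congr rfl fun p hp => by simp only [hinv p hp]

/-- The relative interiors of different faces of a simplex are disjoint. -/
theorem disjoint_openHull {s t u : Finset (ι → ℝ)}
    (hs : AffineIndependent ℝ ((↑) : s → (ι → ℝ))) (ht : t ⊆ s) (hu : u ⊆ s) (htu : t ≠ u) :
    Disjoint (openHull t) (openHull u) := by
  classical
  rw [Set.disjoint_left]
  rintro x ⟨w, hw, h1, rfl⟩ ⟨w', hw', h1', h⟩
  have ext0 : ∀ (t : Finset (ι → ℝ)) (w : (ι → ℝ) → ℝ), t ⊆ s →
      ∑ p ∈ s, (if p ∈ t then w p else 0) = ∑ p ∈ t, w p := fun t w ht => by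
    rw [Finset.sum_ite_mem, Finset.inter_eq_right.2 ht]
  have ext1 : ∀ (t : Finset (ι → ℝ)) (w : (ι → ℝ) → ℝ), t ⊆ s →
      ∑ p ∈ s, (if p ∈ t then w p else 0) • p = ∑ p ∈ t, w p • p := fun t w ht => by
    simp only [ite_smul, zero_smul]
    rw [Finset.sum_ite_mem, Finset.inter_eq_right.2 ht]
  -- The difference of the two weight functions, extended by zero, is an affine relation, hence
  -- zero; but it is nonzero at a vertex belonging to only one of the faces.
  have key := affineIndependent_finset_iff.1 hs
    (fun p => (if p ∈ t then w p else 0) - (if p ∈ u then w' p else 0)) ?_ ?_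
  · apply htu
    ext p
    constructor
    · intro hp
      by_contra hpu
      have := key p (ht hp)
      simp only [hp, hpu, if_true, if_false] at this
      linarith [hw p hp]
    · intro hp
      by_contra hpu
      have := key p (hu hp)
      simp only [hp, hpu, if_true, if_false] at this
      linarith [hw' p hp]
  · rw [Finset.sum_sub_distrib, ext0 t w ht, ext0 u w' hu, h1, h1', sub_self]
  · simp only [sub_smul]
    rw [Finset.sum_sub_distrib, ext1 t w ht, ext1 u w' hu, h, sub_self]

/-- Affine maps that agree on the relative interior of a simplex agree at its vertices. -/
theorem eq_of_eqOn_openHull {E : Type*} [AddCommGroup E] [Module ℝ E] {s : Finset (ι → ℝ)}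
    {f g : (ι → ℝ) →ᵃ[ℝ] E} (h : ∀ x ∈ openHull s, f x = g x) {p : ι → ℝ} (hp : p ∈ s) :
    f p = g p := by
  classical
  obtain ⟨x, hx⟩ := openHull_nonempty ⟨p, hp⟩
  -- The midpoint of an interior point and a vertex is interior; agreement at the midpoint and at
  -- `x` forces agreement at `p`.
  have hmem : AffineMap.lineMap x p (1 / 2 : ℝ) ∈ openHull s := by
    obtain ⟨w, hw, h1, rfl⟩ := hx
    refine ⟨fun q => (1 / 2 : ℝ) * w q + if q = p then 1 / 2 else 0, fun q hq => ?_, ?_, ?_⟩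
    · have := hw q hq
      dsimp only
      split_ifs <;> linarith
    · rw [Finset.sum_add_distrib, ← Finset.mul_sum, h1, Finset.sum_ite_eq' s p, if_pos hp]
      norm_num
    · simp only [add_smul, Finset.sum_add_distrib, mul_smul, ← Finset.smul_sum, ite_smul, zero_smul]
      rw [Finset.sum_ite_eq' s p (fun q => (1 / 2 : ℝ) • q), if_pos hp,
        AffineMap.lineMap_apply_module]
      norm_num
  have h2 := h _ hmem
  rw [AffineMap.apply_lineMap, AffineMap.apply_lineMap, h x hx, AffineMap.lineMap_apply_module,
    AffineMap.lineMap_apply_module] at h2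
  have h3 := add_left_cancel h2
  exact smul_right_injective E (by norm_num : (1 / 2 : ℝ) ≠ 0) h3

/-- The simplex with the given vertices, without its proper faces. -/
def PartialSimplex.ofOpen (s : Finset (ι → ℝ)) (hs : s.Nonempty)
    (hi : AffineIndependent ℝ ((↑) : s → (ι → ℝ))) : PartialSimplex ι where
  vertices := s
  nonempty := hs
  indep := hi
  removed := {t | t ⊂ s}
  removed_ssubset _ ht := ht

theorem PartialSimplex.ofOpen_carrier (s : Finset (ι → ℝ)) (hs : s.Nonempty)
    (hi : AffineIndependent ℝ ((↑) : s → (ι → ℝ))) :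
    (PartialSimplex.ofOpen s hs hi).carrier = openHull s := by
  apply subset_antisymm
  · rintro x ⟨hx, hx'⟩
    change x ∈ convexHull ℝ (s : Set (ι → ℝ)) at hx
    obtain ⟨t, ht, hxt⟩ := mem_convexHull_iff_exists_openHull.1 hx
    by_contra h
    have hne : t ≠ s := by
      rintro rfl
      exact h hxt
    exact hx' (Set.mem_iUnion₂.2 ⟨t, Finset.ssubset_iff_subset_ne.2 ⟨ht, hne⟩, hxt⟩)
  · intro x hx
    refine ⟨openHull_subset_convexHull s hx, fun h => ?_⟩
    obtain ⟨t, ht, hxt⟩ := Set.mem_iUnion₂.1 h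
    have ht : t ⊂ s := ht
    exact Set.disjoint_left.1 (disjoint_openHull hi ht.1 subset_rfl ht.ne) hxt hx

end OpenHull

/-! ### Simplex partitions and stellar subdivision of an edge. -/

section Subdivision

variable {ι : Type*}

/-- A partition of a set into finitely many relative interiors of simplices. -/
structure IsSimplexPartition (X : Set (ι → ℝ)) (𝒞 : Set (Finset (ι → ℝ))) : Prop where
  finite : 𝒞.Finite
  nonempty : ∀ s ∈ 𝒞, s.Nonempty
  indep : ∀ s ∈ 𝒞, AffineIndependent ℝ ((↑) : s → (ι → ℝ))
  disjoint : ∀ s ∈ 𝒞, ∀ t ∈ 𝒞, s ≠ t → Disjoint (openHull s) (openHull t)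
  union_eq : ⋃ s ∈ 𝒞, openHull s = X

theorem IsSimplexPartition.subset {X : Set (ι → ℝ)} {𝒞 : Set (Finset (ι → ℝ))}
    (h : IsSimplexPartition X 𝒞) {s : Finset (ι → ℝ)} (hs : s ∈ 𝒞) : openHull s ⊆ X := by
  rw [← h.union_eq]
  exact Set.subset_biUnion_of_mem (u := openHull) hs

theorem IsSimplexPartition.singleton {s : Finset (ι → ℝ)} (hne : s.Nonempty)
    (hs : AffineIndependent ℝ ((↑) : s → (ι → ℝ))) : IsSimplexPartition (openHull s) {s} where
  finite := Set.finite_singleton s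
  nonempty := by simpa using hne
  indep := by
    rintro t rfl
    exact hs
  disjoint := by
    rintro t rfl u rfl h
    exact absurd rfl h
  union_eq := by simp

theorem IsSimplexPartition.bind {X : Set (ι → ℝ)} {𝒞 : Set (Finset (ι → ℝ))}
    (h : IsSimplexPartition X 𝒞) {𝒟 : Finset (ι → ℝ) → Set (Finset (ι → ℝ))}
    (h𝒟 : ∀ s ∈ 𝒞, IsSimplexPartition (openHull s) (𝒟 s)) :
    IsSimplexPartition X (⋃ s ∈ 𝒞, 𝒟 s) where
  finite := h.finite.biUnion fun s hs => (h𝒟 s hs).finite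
  nonempty t ht := by
    obtain ⟨s, hs, ht⟩ := Set.mem_iUnion₂.1 ht
    exact (h𝒟 s hs).nonempty t ht
  indep t ht := by
    obtain ⟨s, hs, ht⟩ := Set.mem_iUnion₂.1 ht
    exact (h𝒟 s hs).indep t ht
  disjoint t ht t' ht' hne := by
    obtain ⟨s, hs, ht⟩ := Set.mem_iUnion₂.1 ht
    obtain ⟨s', hs', ht'⟩ := Set.mem_iUnion₂.1 ht'
    rcases eq_or_ne s s' with rfl | hss
    · exact (h𝒟 s hs).disjoint t ht t' ht' hne
    · exact (h.disjoint s hs s' hs' hss).mono ((h𝒟 s hs).subset ht) ((h𝒟 s' hs').subset ht')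
  union_eq := by
    rw [← h.union_eq]
    ext x
    simp only [Set.mem_iUnion]
    constructor
    · rintro ⟨t, ⟨s, hs, ht⟩, hx⟩
      exact ⟨s, hs, (h𝒟 s hs).subset ht hx⟩
    · rintro ⟨s, hs, hx⟩
      rw [← (h𝒟 s hs).union_eq] at hx
      obtain ⟨t, ht, hx⟩ := Set.mem_iUnion₂.1 hx
      exact ⟨t, ⟨s, hs, ht⟩, hx⟩

variable [DecidableEq (ι → ℝ)]

theorem mem_openHull_insert {m : ι → ℝ} {r : Finset (ι → ℝ)} (hm : m ∉ r) {x : ι → ℝ} :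
    x ∈ openHull (insert m r) ↔ ∃ (a : ℝ) (k : (ι → ℝ) → ℝ), 0 < a ∧ (∀ p ∈ r, 0 < k p) ∧
      a + ∑ p ∈ r, k p = 1 ∧ a • m + ∑ p ∈ r, k p • p = x := by
  constructor
  · rintro ⟨w, hw, h1, h2⟩
    rw [Finset.sum_insert hm] at h1 h2
    exact ⟨w m, w, hw m (by simp), fun p hp => hw p (by simp [hp]), h1, h2⟩
  · rintro ⟨a, k, ha, hk, h1, h2⟩
    have hne : ∀ p ∈ r, p ≠ m := fun p hp h => hm (h ▸ hp)
    refine ⟨fun p => if p = m then a else k p, fun p hp => ?_, ?_, ?_⟩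
    · dsimp only
      split_ifs with h
      · exact ha
      · exact hk p ((Finset.mem_insert.1 hp).resolve_left h)
    · rw [Finset.sum_insert hm, if_pos rfl, ← h1]
      congr 1
      exact Finset.sum_congr rfl fun p hp => if_neg (hne p hp)
    · rw [Finset.sum_insert hm]
      dsimp only
      rw [if_pos rfl, ← h2]
      congr 1
      exact Finset.sum_congr rfl fun p hp => by rw [if_neg (hne p hp)]

/-- With the weights of the two ends of an edge singled out, subdividing the edge only concerns
these two numbers. -/
theorem mem_openHull_insert_insert {u w : ι → ℝ} {r : Finset (ι → ℝ)} (huw : u ≠ w) (hu : u ∉ r)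
    (hw : w ∉ r) {x : ι → ℝ} :
    x ∈ openHull (insert u (insert w r)) ↔ ∃ (a b : ℝ) (k : (ι → ℝ) → ℝ), 0 < a ∧ 0 < b ∧
      (∀ p ∈ r, 0 < k p) ∧ a + b + ∑ p ∈ r, k p = 1 ∧
      a • u + b • w + ∑ p ∈ r, k p • p = x := by
  have hu' : u ∉ insert w r := by simp [huw, hu]
  have hne : ∀ p ∈ r, p ≠ w := fun p hp h => hw (h ▸ hp)
  rw [mem_openHull_insert hu']
  constructor
  · rintro ⟨a, k, ha, hk, h1, h2⟩
    rw [Finset.sum_insert hw] at h1 h2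
    exact ⟨a, k w, k, ha, hk w (by simp), fun p hp => hk p (by simp [hp]), by rw [← h1, add_assoc],
      by rw [← h2, add_assoc]⟩
  · rintro ⟨a, b, k, ha, hb, hk, h1, h2⟩
    refine ⟨a, fun p => if p = w then b else k p, ha, fun p hp => ?_, ?_, ?_⟩
    · dsimp only
      split_ifs with h
      · exact hb
      · exact hk p ((Finset.mem_insert.1 hp).resolve_left h)
    · rw [Finset.sum_insert hw, if_pos rfl, ← h1, add_assoc]
      congr 2
      exact Finset.sum_congr rfl fun p hp => if_neg (hne p hp)
    · rw [Finset.sum_insert hw]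
      dsimp only
      rw [if_pos rfl, ← h2, add_assoc]
      congr 2
      exact Finset.sum_congr rfl fun p hp => by rw [if_neg (hne p hp)]

theorem affineIndependent_insert_insert_iff {u w : ι → ℝ} {r : Finset (ι → ℝ)} (huw : u ≠ w)
    (hu : u ∉ r) (hw : w ∉ r) :
    AffineIndependent ℝ ((↑) : ↥(insert u (insert w r)) → (ι → ℝ)) ↔
      ∀ (a b : ℝ) (k : (ι → ℝ) → ℝ), a + b + ∑ p ∈ r, k p = 0 →
        a • u + b • w + ∑ p ∈ r, k p • p = 0 → a = 0 ∧ b = 0 ∧ ∀ p ∈ r, k p = 0 := by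
  have hu' : u ∉ insert w r := by simp [huw, hu]
  have hneu : ∀ p ∈ r, p ≠ u := fun p hp h => hu (h ▸ hp)
  have hnew : ∀ p ∈ r, p ≠ w := fun p hp h => hw (h ▸ hp)
  rw [affineIndependent_finset_iff]
  constructor
  · intro h a b k h1 h2
    have key := h (fun p => if p = u then a else if p = w then b else k p) ?_ ?_
    · refine ⟨by simpa using key u (by simp), by simpa [huw.symm] using key w (by simp),
        fun p hp => by simpa [hneu p hp, hnew p hp] using key p (by simp [hp])⟩
    · rw [Finset.sum_insert hu', Finset.sum_insert hw, if_pos rfl, if_neg huw.symm, if_pos rfl,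
        ← h1, add_assoc]
      congr 2
      exact Finset.sum_congr rfl fun p hp => by rw [if_neg (hneu p hp), if_neg (hnew p hp)]
    · rw [Finset.sum_insert hu', Finset.sum_insert hw, if_pos rfl, if_neg huw.symm, if_pos rfl,
        ← h2, add_assoc]
      congr 2
      exact Finset.sum_congr rfl fun p hp => by rw [if_neg (hneu p hp), if_neg (hnew p hp)]
  · intro h k h1 h2
    rw [Finset.sum_insert hu', Finset.sum_insert hw, ← add_assoc] at h1 h2
    obtain ⟨ha, hb, hk⟩ := h _ _ k h1 h2
    intro p hp
    rcases Finset.mem_insert.1 hp with rfl | hp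
    · exact ha
    · rcases Finset.mem_insert.1 hp with rfl | hp
      · exact hb
      · exact hk p hp

/-- The subdivision of a simplex at an interior point of an edge. -/
theorem isSimplexPartition_stellar {u w m : ι → ℝ} {r : Finset (ι → ℝ)} (huw : u ≠ w)
    (hu : u ∉ r) (hw : w ∉ r)
    (hs : AffineIndependent ℝ ((↑) : ↥(insert u (insert w r)) → (ι → ℝ)))
    {α β : ℝ} (hα : 0 < α) (hβ : 0 < β) (hαβ : α + β = 1) (hm : m = α • u + β • w) :
    m ∉ r ∧ m ≠ u ∧ m ≠ w ∧
    IsSimplexPartition (openHull (insert u (insert w r)))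
      {insert m (insert w r), insert m (insert u r), insert m r} := by
  have hs' := (affineIndependent_insert_insert_iff huw hu hw).1 hs
  have hmr : m ∉ r := by
    intro h
    have := (hs' α β (fun p => if p = m then -1 else 0) (by simp [h, hαβ])
      (by simp [h, hm.symm])).1
    exact hα.ne' this
  have hmu : m ≠ u := by
    intro h
    have := (hs' (α - 1) β 0 (by simp; linarith)
      (by simp only [Pi.zero_apply, zero_smul, Finset.sum_const_zero, sub_smul, one_smul]
          rw [sub_add_eq_add_sub, ← hm, h]; simp)).2.1
    exact hβ.ne' this
  have hmw : m ≠ w := by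
    intro h
    have := (hs' α (β - 1) 0 (by simp; linarith)
      (by simp only [Pi.zero_apply, zero_smul, Finset.sum_const_zero, sub_smul, one_smul]
          rw [← add_sub_assoc, ← hm, h]; simp)).1
    exact hα.ne' this
  have indep_w : AffineIndependent ℝ ((↑) : ↥(insert m (insert w r)) → (ι → ℝ)) := by
    rw [affineIndependent_insert_insert_iff hmw hmr hw]
    intro a b k h1 h2
    obtain ⟨h3, h4, h5⟩ := hs' (a * α) (a * β + b) k
      (by rw [← h1]; linear_combination a * hαβ) (by rw [← h2, hm]; module)
    have ha : a = 0 := (mul_eq_zero.1 h3).resolve_right hα.ne'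
    exact ⟨ha, by simpa [ha] using h4, h5⟩
  have indep_u : AffineIndependent ℝ ((↑) : ↥(insert m (insert u r)) → (ι → ℝ)) := by
    rw [affineIndependent_insert_insert_iff hmu hmr hu]
    intro a b k h1 h2
    obtain ⟨h3, h4, h5⟩ := hs' (a * α + b) (a * β) k
      (by rw [← h1]; linear_combination a * hαβ) (by rw [← h2, hm]; module)
    have ha : a = 0 := (mul_eq_zero.1 h4).resolve_right hβ.ne'
    exact ⟨ha, by simpa [ha] using h3, h5⟩
  -- The weights of `u` and `w` are determined by the point; this separates the three parts.
  have weights : ∀ {a b a' b' : ℝ} {k k' : (ι → ℝ) → ℝ} {x : ι → ℝ},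
      a + b + ∑ p ∈ r, k p = 1 → a • u + b • w + ∑ p ∈ r, k p • p = x →
      a' + b' + ∑ p ∈ r, k' p = 1 → a' • u + b' • w + ∑ p ∈ r, k' p • p = x →
      a = a' ∧ b = b' := by
    intro a b a' b' k k' x h1 h2 h1' h2'
    obtain ⟨h3, h4, -⟩ := hs' (a - a') (b - b') (k - k')
      (by simp only [Pi.sub_apply, Finset.sum_sub_distrib]; linarith)
      (by simp only [Pi.sub_apply, sub_smul, Finset.sum_sub_distrib]
          rw [← sub_eq_zero.2 (h2.trans h2'.symm)]; abel)
    exact ⟨sub_eq_zero.1 h3, sub_eq_zero.1 h4⟩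
  have mem_w : ∀ {x}, x ∈ openHull (insert m (insert w r)) → ∃ (a b : ℝ) (k : (ι → ℝ) → ℝ),
      0 < a ∧ 0 < b ∧ (∀ p ∈ r, 0 < k p) ∧ a * α + (a * β + b) + ∑ p ∈ r, k p = 1 ∧
      (a * α) • u + (a * β + b) • w + ∑ p ∈ r, k p • p = x := by
    intro x hx
    obtain ⟨a, b, k, ha, hb, hk, h1, h2⟩ := (mem_openHull_insert_insert hmw hmr hw).1 hx
    exact ⟨a, b, k, ha, hb, hk, by rw [← h1]; linear_combination a * hαβ, by rw [← h2, hm]; module⟩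
  have mem_u : ∀ {x}, x ∈ openHull (insert m (insert u r)) → ∃ (a b : ℝ) (k : (ι → ℝ) → ℝ),
      0 < a ∧ 0 < b ∧ (∀ p ∈ r, 0 < k p) ∧ (a * α + b) + a * β + ∑ p ∈ r, k p = 1 ∧
      (a * α + b) • u + (a * β) • w + ∑ p ∈ r, k p • p = x := by
    intro x hx
    obtain ⟨a, b, k, ha, hb, hk, h1, h2⟩ := (mem_openHull_insert_insert hmu hmr hu).1 hx
    exact ⟨a, b, k, ha, hb, hk, by rw [← h1]; linear_combination a * hαβ, by rw [← h2, hm]; module⟩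
  have mem_m : ∀ {x}, x ∈ openHull (insert m r) → ∃ (a : ℝ) (k : (ι → ℝ) → ℝ),
      0 < a ∧ (∀ p ∈ r, 0 < k p) ∧ a * α + a * β + ∑ p ∈ r, k p = 1 ∧
      (a * α) • u + (a * β) • w + ∑ p ∈ r, k p • p = x := by
    intro x hx
    obtain ⟨a, k, ha, hk, h1, h2⟩ := (mem_openHull_insert hmr).1 hx
    exact ⟨a, k, ha, hk, by rw [← h1]; linear_combination a * hαβ, by rw [← h2, hm]; module⟩
  have d1 : Disjoint (openHull (insert m (insert w r))) (openHull (insert m (insert u r))) := by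
    rw [Set.disjoint_left]
    intro x hx hx'
    obtain ⟨a, b, k, ha, hb, hk, h1, h2⟩ := mem_w hx
    obtain ⟨a', b', k', ha', hb', hk', h1', h2'⟩ := mem_u hx'
    obtain ⟨h3, h4⟩ := weights h1 h2 h1' h2'
    nlinarith [mul_pos hα hb, mul_pos hβ hb']
  have d2 : Disjoint (openHull (insert m (insert w r))) (openHull (insert m r)) := by
    rw [Set.disjoint_left]
    intro x hx hx'
    obtain ⟨a, b, k, ha, hb, hk, h1, h2⟩ := mem_w hx
    obtain ⟨a', k', ha', hk', h1', h2'⟩ := mem_m hx'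
    obtain ⟨h3, h4⟩ := weights h1 h2 h1' h2'
    have : a = a' := mul_right_cancel₀ hα.ne' h3
    rw [this] at h4
    linarith
  have d3 : Disjoint (openHull (insert m (insert u r))) (openHull (insert m r)) := by
    rw [Set.disjoint_left]
    intro x hx hx'
    obtain ⟨a, b, k, ha, hb, hk, h1, h2⟩ := mem_u hx
    obtain ⟨a', k', ha', hk', h1', h2'⟩ := mem_m hx'
    obtain ⟨h3, h4⟩ := weights h1 h2 h1' h2'
    have : a = a' := mul_right_cancel₀ hβ.ne' h4
    rw [this] at h3
    linarith
  refine ⟨hmr, hmu, hmw, ?_, ?_, ?_, ?_, ?_⟩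
  · exact Set.toFinite _
  · rintro s (rfl | rfl | rfl) <;> exact Finset.insert_nonempty _ _
  · rintro s (rfl | rfl | rfl)
    · exact indep_w
    · exact indep_u
    · exact indep_w.mono (Finset.coe_subset.2 (Finset.insert_subset_insert _
        (Finset.subset_insert _ _)))
  · rintro s (rfl | rfl | rfl) t (rfl | rfl | rfl) hne
    · exact absurd rfl hne
    · exact d1
    · exact d2
    · exact d1.symm
    · exact absurd rfl hne
    · exact d3
    · exact d2.symm
    · exact d3.symm
    · exact absurd rfl hne
  · ext x
    simp only [Set.mem_insert_iff, Set.mem_singleton_iff, Set.iUnion_iUnion_eq_or_left,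
      Set.iUnion_iUnion_eq_left, Set.mem_union]
    rw [mem_openHull_insert_insert huw hu hw]
    constructor
    · rintro (hx | hx | hx)
      · obtain ⟨a, b, k, ha, hb, hk, h1, h2⟩ := mem_w hx
        exact ⟨_, _, k, by positivity, by positivity, hk, h1, h2⟩
      · obtain ⟨a, b, k, ha, hb, hk, h1, h2⟩ := mem_u hx
        exact ⟨_, _, k, by positivity, by positivity, hk, h1, h2⟩
      · obtain ⟨a, k, ha, hk, h1, h2⟩ := mem_m hx
        exact ⟨_, _, k, by positivity, by positivity, hk, h1, h2⟩
    · rintro ⟨a, b, k, ha, hb, hk, h1, h2⟩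
      -- Give `m` as much weight as the weights `a` of `u` and `b` of `w` allow, which is the
      -- smaller quotient. That uses up `u`, both ends, or `w`, and so decides the part.
      rcases lt_trichotomy (a / α) (b / β) with h | h | h
      · left
        have hb' : 0 < b - a / α * β := by
          rw [lt_div_iff₀ hβ] at h
          linarith
        refine (mem_openHull_insert_insert hmw hmr hw).2
          ⟨a / α, b - a / α * β, k, by positivity, hb', hk, ?_, ?_⟩
        · rw [← h1]
          have : a / α * α = a := div_mul_cancel₀ _ hα.ne'
          linear_combination this - a / α * hαβ
        · have : a = a / α * α := (div_mul_cancel₀ _ hα.ne').symm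
          rw [← h2, hm]
          conv_rhs => rw [this]
          module
      · right; right
        refine (mem_openHull_insert hmr).2 ⟨a / α, k, by positivity, hk, ?_, ?_⟩
        · have h3 : a / α * α = a := div_mul_cancel₀ _ hα.ne'
          have h4 : b / β * β = b := div_mul_cancel₀ _ hβ.ne'
          rw [← h] at h4
          rw [← h1]
          linear_combination h3 + h4 - a / α * hαβ
        · have h3 : a / α * α = a := div_mul_cancel₀ _ hα.ne'
          have h4 : b / β * β = b := div_mul_cancel₀ _ hβ.ne'
          rw [← h] at h4
          rw [← h2, hm, smul_add, smul_smul, smul_smul, h3, h4]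
      · right; left
        have ha' : 0 < a - b / β * α := by
          have h := (lt_div_iff₀ hα).1 h
          linarith
        refine (mem_openHull_insert_insert hmu hmr hu).2
          ⟨b / β, a - b / β * α, k, by positivity, ha', hk, ?_, ?_⟩
        · rw [← h1]
          have : b / β * β = b := div_mul_cancel₀ _ hβ.ne'
          linear_combination this - b / β * hαβ
        · have : b = b / β * β := (div_mul_cancel₀ _ hβ.ne').symm
          rw [← h2, hm]
          conv_rhs => rw [this]
          module

end Subdivision

/-! ### Subdivision according to the signs of affine functions. -/

section SignPartition

variable {ι : Type*}

/-- With positive weights and nonnegative vertex values, `f` is zero throughout if all vertex values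
vanish, and positive throughout otherwise. -/
theorem sign_eq_of_mem_openHull {s : Finset (ι → ℝ)} {f : (ι → ℝ) →ᵃ[ℝ] ℝ}
    (hf : ∀ p ∈ s, 0 ≤ f p) {x y : ι → ℝ} (hx : x ∈ openHull s) (hy : y ∈ openHull s) :
    SignType.sign (f x) = SignType.sign (f y) := by
  by_cases h0 : ∀ p ∈ s, f p = 0
  · have key : ∀ z ∈ openHull s, f z = 0 := by
      rintro z ⟨w, hw, h1, rfl⟩
      rw [affineMap_sum_smul f s w h1]
      exact Finset.sum_eq_zero fun p hp => by rw [h0 p hp, smul_zero]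
    rw [key x hx, key y hy]
  · push Not at h0
    obtain ⟨p, hp, hp0⟩ := h0
    have key : ∀ z ∈ openHull s, 0 < f z := by
      rintro z ⟨w, hw, h1, rfl⟩
      rw [affineMap_sum_smul f s w h1]
      refine Finset.sum_pos' (fun q hq => mul_nonneg (hw q hq).le (hf q hq)) ⟨p, hp, ?_⟩
      exact mul_pos (hw p hp) (lt_of_le_of_ne (hf p hp) (Ne.symm hp0))
    rw [sign_pos (key x hx), sign_pos (key y hy)]

/-- A simplex can be subdivided such that a given affine function has constant sign on each part. -/
theorem exists_isSimplexPartition_sign (f : (ι → ℝ) →ᵃ[ℝ] ℝ) (s : Finset (ι → ℝ))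
    (hne : s.Nonempty) (hs : AffineIndependent ℝ ((↑) : s → (ι → ℝ))) :
    ∃ 𝒞, IsSimplexPartition (openHull s) 𝒞 ∧ ∀ t ∈ 𝒞, ∀ x ∈ openHull t, ∀ y ∈ openHull t,
      SignType.sign (f x) = SignType.sign (f y) := by
  classical
  -- An edge on which `f` changes sign is split at its zero `m`. Each part trades an end of nonzero
  -- value for `m`, or both ends, so the number of vertices with `f p ≠ 0` drops.
  induction h : (s.filter fun p => f p ≠ 0).card using Nat.strong_induction_on generalizing s with
  | _ n ih =>
  by_cases hpos : ∀ p ∈ s, 0 ≤ f p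
  · refine ⟨_, IsSimplexPartition.singleton hne hs, ?_⟩
    rintro t rfl x hx y hy
    exact sign_eq_of_mem_openHull hpos hx hy
  by_cases hneg : ∀ p ∈ s, f p ≤ 0
  · refine ⟨_, IsSimplexPartition.singleton hne hs, ?_⟩
    rintro t rfl x hx y hy
    have := sign_eq_of_mem_openHull (f := -f) (fun p hp => by simpa using hneg p hp) hx hy
    simpa [Left.sign_neg] using this
  push Not at hpos hneg
  obtain ⟨w, hw, hfw⟩ := hpos
  obtain ⟨u, hu, hfu⟩ := hneg
  have huw : u ≠ w := by
    rintro rfl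
    exact lt_asymm hfw hfu
  obtain ⟨r, hur, hwr, rfl⟩ : ∃ r : Finset (ι → ℝ), u ∉ r ∧ w ∉ r ∧ s = insert u (insert w r) := by
    refine ⟨(s.erase u).erase w, by simp, by simp, ?_⟩
    rw [Finset.insert_erase (Finset.mem_erase.2 ⟨huw.symm, hw⟩), Finset.insert_erase hu]
  have hd : 0 < f u - f w := by linarith
  have hαβ : -f w / (f u - f w) + f u / (f u - f w) = 1 := by
    field_simp
    ring
  obtain ⟨hmr, hmu, hmw, hpart⟩ := isSimplexPartition_stellar huw hur hwr hs
    (div_pos (neg_pos.2 hfw) hd) (div_pos hfu hd) hαβ rfl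
  set m := (-f w / (f u - f w)) • u + (f u / (f u - f w)) • w with hm
  have hfm : f m = 0 := by
    have h1 : f m = AffineMap.lineMap (f w) (f u) (-f w / (f u - f w)) := by
      rw [← AffineMap.apply_lineMap, AffineMap.lineMap_apply_module, hm, add_comm]
      congr 3
      linarith
    rw [h1, AffineMap.lineMap_apply]
    simp only [vsub_eq_sub, smul_eq_mul, vadd_eq_add]
    field_simp
    ring
  have hcard : ((insert u (insert w r)).filter fun p => f p ≠ 0).card
      = (r.filter fun p => f p ≠ 0).card + 2 := by
    rw [Finset.filter_insert, if_pos hfu.ne', Finset.filter_insert, if_pos hfw.ne,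
      Finset.card_insert_of_notMem (by simp [huw, hur]), Finset.card_insert_of_notMem (by simp [hwr])]
  rw [hcard] at h
  have key : ∀ t ∈ ({insert m (insert w r), insert m (insert u r), insert m r} :
      Set (Finset (ι → ℝ))), ∃ 𝒞, IsSimplexPartition (openHull t) 𝒞 ∧ ∀ c ∈ 𝒞, ∀ x ∈ openHull c,
      ∀ y ∈ openHull c, SignType.sign (f x) = SignType.sign (f y) := by
    intro t ht
    refine ih _ ?_ t (hpart.nonempty t ht) (hpart.indep t ht) rfl
    rw [← h]
    rcases ht with rfl | rfl | rfl
    · rw [Finset.filter_insert, if_neg (by simp [hfm]), Finset.filter_insert, if_pos hfw.ne,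
        Finset.card_insert_of_notMem (by simp [hwr])]
      omega
    · rw [Finset.filter_insert, if_neg (by simp [hfm]), Finset.filter_insert, if_pos hfu.ne',
        Finset.card_insert_of_notMem (by simp [hur])]
      omega
    · rw [Finset.filter_insert, if_neg (by simp [hfm])]
      omega
  choose! 𝒟 h𝒟 h𝒟' using key
  refine ⟨_, hpart.bind h𝒟, fun t ht => ?_⟩
  obtain ⟨c, hc, ht⟩ := Set.mem_iUnion₂.1 ht
  exact h𝒟' c hc t ht

theorem IsSimplexPartition.exists_refinement {X : Set (ι → ℝ)} {𝒞 : Set (Finset (ι → ℝ))}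
    (h𝒞 : IsSimplexPartition X 𝒞) {F : Set ((ι → ℝ) →ᵃ[ℝ] ℝ)} (hF : F.Finite) :
    ∃ 𝒟, IsSimplexPartition X 𝒟 ∧ ∀ t ∈ 𝒟, ∀ f ∈ F, ∀ x ∈ openHull t, ∀ y ∈ openHull t,
      SignType.sign (f x) = SignType.sign (f y) := by
  induction F, hF using Set.Finite.induction_on with
  | empty => exact ⟨𝒞, h𝒞, by simp⟩
  | @insert f F _ _ ih =>
    obtain ⟨𝒟, h𝒟, hF⟩ := ih
    have key : ∀ t ∈ 𝒟, ∃ ℰ, IsSimplexPartition (openHull t) ℰ ∧ ∀ c ∈ ℰ, ∀ x ∈ openHull c,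
        ∀ y ∈ openHull c, SignType.sign (f x) = SignType.sign (f y) := fun t ht =>
      exists_isSimplexPartition_sign f t (h𝒟.nonempty t ht) (h𝒟.indep t ht)
    choose! ℰ hℰ hℰ' using key
    refine ⟨_, h𝒟.bind hℰ, fun c hc => ?_⟩
    obtain ⟨t, ht, hc⟩ := Set.mem_iUnion₂.1 hc
    rintro g (rfl | hg) x hx y hy
    · exact hℰ' t ht c hc x hx y hy
    · exact hF t ht g hg x ((hℰ t ht).subset hc hx) y ((hℰ t ht).subset hc hy)

/-- Sets such that membership of a point depends only on the signs that finitely many affine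
functions have there. -/
def SignDetermined (X : Set (ι → ℝ)) : Prop :=
  ∃ F : Set ((ι → ℝ) →ᵃ[ℝ] ℝ), F.Finite ∧ ∀ x y, (∀ f ∈ F, SignType.sign (f x) = SignType.sign (f y)) →
    x ∈ X → y ∈ X

theorem signDetermined_univ : SignDetermined (Set.univ : Set (ι → ℝ)) :=
  ⟨∅, Set.finite_empty, fun _ _ _ _ => trivial⟩

theorem SignDetermined.compl {X : Set (ι → ℝ)} (h : SignDetermined X) : SignDetermined Xᶜ := by
  obtain ⟨F, hF, h⟩ := h
  exact ⟨F, hF, fun x y hxy hx hy => hx (h y x (fun f hf => (hxy f hf).symm) hy)⟩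

theorem SignDetermined.inter {X Y : Set (ι → ℝ)} (hX : SignDetermined X) (hY : SignDetermined Y) :
    SignDetermined (X ∩ Y) := by
  obtain ⟨F, hF, hX⟩ := hX
  obtain ⟨G, hG, hY⟩ := hY
  exact ⟨F ∪ G, hF.union hG, fun x y hxy hx => ⟨hX x y (fun f hf => hxy f (Or.inl hf)) hx.1,
    hY x y (fun f hf => hxy f (Or.inr hf)) hx.2⟩⟩

theorem SignDetermined.iUnion {α : Sort*} [Finite α] {X : α → Set (ι → ℝ)}
    (hX : ∀ a, SignDetermined (X a)) : SignDetermined (⋃ a, X a) := by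
  choose F hF h using hX
  refine ⟨⋃ a, F a, Set.finite_iUnion hF, fun x y hxy hx => ?_⟩
  obtain ⟨a, ha⟩ := Set.mem_iUnion.1 hx
  exact Set.mem_iUnion.2 ⟨a, h a x y (fun f hf => hxy f (Set.mem_iUnion.2 ⟨a, hf⟩)) ha⟩

theorem SignDetermined.biUnion {α : Type*} {s : Set α} (hs : s.Finite) {X : α → Set (ι → ℝ)}
    (hX : ∀ a ∈ s, SignDetermined (X a)) : SignDetermined (⋃ a ∈ s, X a) := by
  have := hs.to_subtype
  rw [Set.biUnion_eq_iUnion]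
  exact SignDetermined.iUnion fun a => hX a a.2

theorem SignDetermined.preimage {κ : Type*} {X : Set (ι → ℝ)} (hX : SignDetermined X)
    (g : (κ → ℝ) →ᵃ[ℝ] (ι → ℝ)) : SignDetermined (g ⁻¹' X) := by
  obtain ⟨F, hF, h⟩ := hX
  refine ⟨(fun f => f.comp g) '' F, hF.image _, fun x y hxy hx => h _ _ (fun f hf => ?_) hx⟩
  exact hxy _ (Set.mem_image_of_mem _ hf)

theorem signDetermined_pos (f : (ι → ℝ) →ᵃ[ℝ] ℝ) : SignDetermined {x | 0 < f x} := by
  refine ⟨{f}, Set.finite_singleton f, fun x y hxy hx => ?_⟩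
  have := hxy f rfl
  rw [sign_pos hx] at this
  exact sign_eq_one_iff.1 this.symm

theorem signDetermined_nonneg (f : (ι → ℝ) →ᵃ[ℝ] ℝ) : SignDetermined {x | 0 ≤ f x} := by
  have h := (signDetermined_pos (-f)).compl
  have : {x | 0 < (-f) x}ᶜ = {x | 0 ≤ f x} := by
    ext x
    simp
  rwa [this] at h

end SignPartition

/-! ### Triangulating bounded sets given by affine sign conditions. -/

section Triangulation

variable {ι : Type*}

theorem affineIndependent_image {κ : Type*} [DecidableEq (κ → ℝ)] {s : Finset (ι → ℝ)}
    (hs : AffineIndependent ℝ ((↑) : s → (ι → ℝ))) (f : (ι → ℝ) → (κ → ℝ))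
    (g : (κ → ℝ) →ᵃ[ℝ] (ι → ℝ)) (h : ∀ p ∈ s, g (f p) = p) :
    AffineIndependent ℝ ((↑) : ↥(s.image f) → (κ → ℝ)) := by
  have hinj : Set.InjOn f s := fun p hp q hq hpq => by rw [← h p hp, hpq, h q hq]
  rw [affineIndependent_finset_iff] at hs ⊢
  intro w h0 h1 q hq
  obtain ⟨p, hp, rfl⟩ := Finset.mem_image.1 hq
  rw [Finset.sum_image hinj] at h0 h1
  refine hs (fun p => w (f p)) h0 ?_ p hp
  have hg : ∀ x, g x = g.linear x + g 0 := fun x => congrFun g.decomp x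
  calc ∑ p ∈ s, w (f p) • p = ∑ p ∈ s, (w (f p) • g.linear (f p) + w (f p) • g 0) :=
        Finset.sum_congr rfl fun p hp => by rw [← smul_add, ← hg, h p hp]
    _ = 0 := by
        rw [Finset.sum_add_distrib, ← Finset.sum_smul, h0, zero_smul, add_zero]
        simp_rw [← map_smul]
        rw [← map_sum, h1, map_zero]

/-- Completing `s` to an affine basis makes the barycentric coordinates affine functions on the
whole space rather than on the span of `s`. -/
theorem exists_barycentric_coordinates [Finite ι] {s : Finset (ι → ℝ)}
    (hs : AffineIndependent ℝ ((↑) : s → (ι → ℝ))) :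
    ∃ (t : Finset (ι → ℝ)) (c : (ι → ℝ) → ((ι → ℝ) →ᵃ[ℝ] ℝ)), s ⊆ t ∧ t.Nonempty ∧
      AffineIndependent ℝ ((↑) : t → (ι → ℝ)) ∧
      (∀ p ∈ t, c p p = 1) ∧ (∀ p ∈ t, ∀ q ∈ t, p ≠ q → c p q = 0) ∧
      (∀ x, ∑ p ∈ t, c p x = 1) ∧ ∀ x, ∑ p ∈ t, c p x • p = x := by
  classical
  have := Fintype.ofFinite ι
  obtain ⟨T, hsT, hT, htop⟩ := exists_subset_affineIndependent_affineSpan_eq_top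
    (k := ℝ) (s := (s : Set (ι → ℝ))) hs
  have hfin : T.Finite := finite_set_of_fin_dim_affineIndependent ℝ hT
  lift T to Finset (ι → ℝ) using hfin
  let b : AffineBasis T ℝ (ι → ℝ) := ⟨(↑), hT, by simpa using htop⟩
  have hb : ∀ p : T, b p = p := fun _ => rfl
  refine ⟨T, fun p => if h : p ∈ T then b.coord ⟨p, h⟩ else 0, by exact_mod_cast hsT, ?_, hT,
    ?_, ?_, ?_, ?_⟩
  · obtain ⟨p⟩ := b.nonempty
    exact ⟨p, p.2⟩
  · intro p hp
    simpa [hp, hb] using b.coord_apply_eq ⟨p, hp⟩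
  · intro p hp q hq hpq
    simpa [hp, hb] using b.coord_apply_ne (i := ⟨p, hp⟩) (j := ⟨q, hq⟩) (by simpa using hpq)
  · intro x
    rw [← b.sum_coord_apply_eq_one x, ← Finset.sum_coe_sort T]
    exact Finset.sum_congr rfl fun p _ => by simp
  · intro x
    conv_rhs => rw [← b.linear_combination_coord_eq_self x]
    rw [← Finset.sum_coe_sort T
      (fun p => (if h : p ∈ T then b.coord ⟨p, h⟩ else 0 : (ι → ℝ) →ᵃ[ℝ] ℝ) x • p)]
    exact Finset.sum_congr rfl fun p _ => by simp [hb]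

/-- In the completed basis, the coordinates are positive at the points of `s` and zero at the added
points; these are sign conditions. -/
theorem signDetermined_openHull [Finite ι] {s : Finset (ι → ℝ)}
    (hs : AffineIndependent ℝ ((↑) : s → (ι → ℝ))) : SignDetermined (openHull s) := by
  classical
  obtain ⟨t, c, hst, -, -, hc1, hc0, hsum, hx⟩ := exists_barycentric_coordinates hs
  have key : ∀ x, x ∈ openHull s ↔
      (∀ p ∈ s, SignType.sign (c p x) = 1) ∧ ∀ p ∈ t \ s, SignType.sign (c p x) = 0 := by
    intro x
    simp only [sign_eq_one_iff, sign_eq_zero_iff]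
    constructor
    · rintro ⟨w, hw, h1, rfl⟩
      have hc : ∀ p ∈ t, c p (∑ q ∈ s, w q • q) = if p ∈ s then w p else 0 := by
        intro p hp
        rw [affineMap_sum_smul _ s w h1, ← Finset.sum_ite_eq s p w]
        refine Finset.sum_congr rfl fun q hq => ?_
        split_ifs with h
        · subst h
          simp [hc1 p hp]
        · rw [hc0 p hp q (hst hq) h, smul_zero]
      refine ⟨fun p hp => by rw [hc p (hst hp), if_pos hp]; exact hw p hp, fun p hp => ?_⟩
      rw [Finset.mem_sdiff] at hp
      rw [hc p hp.1, if_neg hp.2]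
    · rintro ⟨h1, h0⟩
      refine ⟨fun p => c p x, h1, ?_, ?_⟩
      · rw [← hsum x]
        exact Finset.sum_subset hst fun p hp hps => h0 p (Finset.mem_sdiff.2 ⟨hp, hps⟩)
      · conv_rhs => rw [← hx x]
        exact Finset.sum_subset hst fun p hp hps => by
          dsimp only
          rw [h0 p (Finset.mem_sdiff.2 ⟨hp, hps⟩), zero_smul]
  refine ⟨c '' t, t.finite_toSet.image c, fun x y hxy => ?_⟩
  have hxy' : ∀ p ∈ t, SignType.sign (c p x) = SignType.sign (c p y) := fun p hp =>
    hxy _ (Set.mem_image_of_mem c hp)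
  rw [key, key]
  rintro ⟨h1, h0⟩
  exact ⟨fun p hp => by rw [← hxy' p (hst hp), h1 p hp],
    fun p hp => by rw [← hxy' p (Finset.mem_sdiff.1 hp).1, h0 p hp]⟩

theorem PartialSimplex.signDetermined [Finite ι] (A : PartialSimplex ι) :
    SignDetermined A.carrier := by
  have h1 : SignDetermined (convexHull ℝ (A.vertices : Set (ι → ℝ))) := by
    have : convexHull ℝ (A.vertices : Set (ι → ℝ))
        = ⋃ t ∈ (A.vertices.powerset : Set (Finset (ι → ℝ))), openHull t := by
      ext x
      rw [mem_convexHull_iff_exists_openHull]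
      simp
    rw [this]
    refine SignDetermined.biUnion (Finset.finite_toSet _) fun t ht => signDetermined_openHull ?_
    exact A.indep.mono (Finset.coe_subset.2 (Finset.mem_powerset.1 ht))
  have hfin : A.removed.Finite := (Finset.finite_toSet A.vertices.powerset).subset
    fun t ht => Finset.mem_coe.2 (Finset.mem_powerset.2 (A.removed_ssubset t ht).1)
  refine h1.inter (SignDetermined.compl (SignDetermined.biUnion hfin fun t ht =>
    signDetermined_openHull ?_))
  exact A.indep.mono (Finset.coe_subset.2 (A.removed_ssubset t ht).1)

theorem PartialSimplex.isBounded [Fintype ι] (A : PartialSimplex ι) :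
    Bornology.IsBounded A.carrier :=
  ((isBounded_convexHull.2 A.vertices.finite_toSet.isBounded)).subset Set.sdiff_subset

/-- The interior of a full-dimensional simplex contains a ball, and a homothety makes the ball as
large as needed. -/
theorem exists_openHull_superset [Fintype ι] {X : Set (ι → ℝ)} (hX : Bornology.IsBounded X) :
    ∃ s : Finset (ι → ℝ), s.Nonempty ∧ AffineIndependent ℝ ((↑) : s → (ι → ℝ)) ∧
      X ⊆ openHull s := by
  classical
  obtain ⟨t, c, -, hne, ht, hc1, hc0, hsum, hx⟩ := exists_barycentric_coordinates
    (ι := ι) (s := ∅) (affineIndependent_of_subsingleton ℝ _)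
  obtain ⟨x₀, w, hw, h1, hx₀⟩ := openHull_nonempty hne
  have hopen : IsOpen {x | ∀ p ∈ t, 0 < c p x} := by
    have : {x | ∀ p ∈ t, 0 < c p x} = ⋂ p ∈ t, {x | 0 < c p x} := by
      ext
      simp
    rw [this]
    exact isOpen_biInter_finset fun p _ =>
      isOpen_lt continuous_const (c p).continuous_of_finiteDimensional
  have hmem : x₀ ∈ {x | ∀ p ∈ t, 0 < c p x} := by
    intro p hp
    rw [← hx₀, affineMap_sum_smul _ t w h1,
      Finset.sum_eq_single_of_mem p hp fun q hq hqp => by rw [hc0 p hp q hq hqp.symm, smul_zero],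
      hc1 p hp, smul_eq_mul, mul_one]
    exact hw p hp
  obtain ⟨ε, hε, hball⟩ := Metric.isOpen_iff.1 hopen x₀ hmem
  obtain ⟨M, hM0, hM⟩ := hX.exists_pos_norm_lt
  have hr : 0 < M / ε := div_pos hM0 hε
  -- `f` takes the ball of radius `ε` about `x₀` to the ball of radius `M` about 0, which contains
  -- `X`; `g` is its inverse.
  let f : (ι → ℝ) →ᵃ[ℝ] (ι → ℝ) := (M / ε) • (AffineMap.id ℝ _ - AffineMap.const ℝ _ x₀)
  let g : (ι → ℝ) →ᵃ[ℝ] (ι → ℝ) := (ε / M) • AffineMap.id ℝ _ + AffineMap.const ℝ _ x₀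
  have hf : ∀ x, f x = (M / ε) • (x - x₀) := fun x => rfl
  have hg : ∀ x, g x = (ε / M) • x + x₀ := fun x => rfl
  have hgf : ∀ x, g (f x) = x := fun x => by
    rw [hf, hg, smul_smul, div_mul_div_cancel₀ hM0.ne', div_self hε.ne', one_smul, sub_add_cancel]
  have hfg : ∀ x, f (g x) = x := fun x => by
    rw [hf, hg, add_sub_cancel_right, smul_smul, div_mul_div_cancel₀ hε.ne', div_self hM0.ne',
      one_smul]
  refine ⟨t.image f, hne.image f, affineIndependent_image ht f g fun p _ => hgf p, fun x hxX => ?_⟩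
  rw [openHull_image f ((Function.LeftInverse.injective hgf).injOn)]
  refine ⟨g x, ⟨fun p => c p (g x), ?_, hsum _, hx _⟩, hfg x⟩
  apply hball
  rw [Metric.mem_ball, dist_eq_norm, hg, add_sub_cancel_right, norm_smul, Real.norm_of_nonneg
    (div_pos hε hM0).le]
  calc ε / M * ‖x‖ < ε / M * M := by
        have := hM x hxX
        gcongr
    _ = ε := div_mul_cancel₀ _ hM0.ne'

/-- A bounded set that is a union of finitely many sign-determined sets can be partitioned into
relative interiors of simplices, each of them contained in one of these sets. -/
theorem exists_isSimplexPartition_subordinate [Fintype ι] {α : Type*} [Finite α]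
    (Y : α → Set (ι → ℝ)) (hY : ∀ a, SignDetermined (Y a))
    (hb : Bornology.IsBounded (⋃ a, Y a)) :
    ∃ 𝒞, IsSimplexPartition (⋃ a, Y a) 𝒞 ∧ ∀ t ∈ 𝒞, ∃ a, openHull t ⊆ Y a := by
  obtain ⟨s, hne, hs, hsub⟩ := exists_openHull_superset hb
  choose F hF h using hY
  obtain ⟨𝒟, h𝒟, hsign⟩ := (IsSimplexPartition.singleton hne hs).exists_refinement
    (Set.finite_iUnion hF)
  -- All defining functions have constant sign on a part, so a part meeting `Y a` lies in it; the
  -- parts meeting no `Y a` are dropped.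
  have key : ∀ t ∈ 𝒟, ∀ x ∈ openHull t, ∀ a, x ∈ Y a → openHull t ⊆ Y a := by
    intro t ht x hx a hxa y hy
    exact h a x y (fun f hf => hsign t ht f (Set.mem_iUnion.2 ⟨a, hf⟩) x hx y hy) hxa
  refine ⟨{t ∈ 𝒟 | ∃ a, openHull t ⊆ Y a}, ⟨h𝒟.finite.subset (Set.sep_subset _ _),
    fun t ht => h𝒟.nonempty t ht.1, fun t ht => h𝒟.indep t ht.1,
    fun t ht u hu => h𝒟.disjoint t ht.1 u hu.1, ?_⟩, fun t ht => ht.2⟩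
  apply subset_antisymm
  · refine Set.iUnion₂_subset fun t ht => ?_
    obtain ⟨a, ha⟩ := ht.2
    exact ha.trans (Set.subset_iUnion Y a)
  · intro x hx
    obtain ⟨a, ha⟩ := Set.mem_iUnion.1 hx
    have hxs := hsub hx
    rw [← h𝒟.union_eq] at hxs
    obtain ⟨t, ht, hxt⟩ := Set.mem_iUnion₂.1 hxs
    exact Set.mem_iUnion₂.2 ⟨t, ⟨ht, a, key t ht x hxt a ha⟩, hxt⟩

end Triangulation

/-! ### Families of monotone paths and sweeps. -/

section Itinerary

/-- A family of monotone paths in `ℝ^ι`, parametrised by a subset of `ℝ^τ`: the path of `v` runs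
through the points `pos 0 v, …, pos len v`, and the segment from `pos i v` to `pos (i + 1) v` has
the direction `dir i`. The parameter can be recovered from any point of the line through this
segment by the map `inv i`. -/
structure Itinerary (τ ι : Type*) [Fintype τ] [Fintype ι] [DecidableEq ι] where
  domain : Set (τ → ℝ)
  len : ℕ
  len_pos : 0 < len
  dir : ℕ → ι
  pos : ℕ → (τ → ℝ) → (ι → ℝ)
  inv : ℕ → (ι → ℝ) → (τ → ℝ)
  pos_int : ∀ i ≤ len, IntAffineMap (pos i)
  inv_int : ∀ i < len, IntAffineMap (inv i)
  inv_add : ∀ i < len, ∀ x (s : ℝ), inv i (x + s • (Pi.single (dir i) 1 : ι → ℝ)) = inv i x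
  inv_pos : ∀ i < len, ∀ v ∈ domain, inv i (pos i v) = v
  step : ∀ i < len, ∀ v ∈ domain,
    ∃ s : ℝ, 0 ≤ s ∧ pos (i + 1) v = pos i v + s • (Pi.single (dir i) 1 : ι → ℝ)

namespace Itinerary

variable {τ ι : Type*} [Fintype τ] [Fintype ι] [DecidableEq ι] (I : Itinerary τ ι)

/-- The point `x` lies on the `i`-th segment of the path of `v`. -/
def Seg (i : ℕ) (v : τ → ℝ) (x : ι → ℝ) : Prop :=
  x = I.pos i v + (rank x - rank (I.pos i v)) • (Pi.single (I.dir i) 1 : ι → ℝ) ∧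
    rank (I.pos i v) ≤ rank x ∧ rank x ≤ rank (I.pos (i + 1) v)

/-- The point `x` lies on the path of `v`. -/
def On (v : τ → ℝ) (x : ι → ℝ) : Prop := ∃ i < I.len, I.Seg i v x

/-- The point `x` lies on the path of `v` and, if `fake` holds, is not one of its end points. -/
def Inside (fake : Prop) (v : τ → ℝ) (x : ι → ℝ) : Prop :=
  I.On v x ∧ (fake → rank (I.pos 0 v) < rank x ∧ rank x < rank (I.pos I.len v))

/-- The length of the path of `v`. -/
def length (v : τ → ℝ) : ℝ := rank (I.pos I.len v) - rank (I.pos 0 v)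

variable {I} {v : τ → ℝ} {x y : ι → ℝ} {i j : ℕ}

theorem pos_succ (hi : i < I.len) (hv : v ∈ I.domain) : I.pos (i + 1) v =
    I.pos i v + (rank (I.pos (i + 1) v) - rank (I.pos i v)) •
      (Pi.single (I.dir i) 1 : ι → ℝ) := by
  obtain ⟨s, -, h⟩ := I.step i hi v hv
  rw [h, rank_add_single, add_sub_cancel_left]

theorem rank_pos_le_succ (hi : i < I.len) (hv : v ∈ I.domain) :
    rank (I.pos i v) ≤ rank (I.pos (i + 1) v) := by
  obtain ⟨s, hs, h⟩ := I.step i hi v hv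
  rw [h, rank_add_single]
  linarith

theorem rank_pos_le (hij : i ≤ j) (hj : j ≤ I.len) (hv : v ∈ I.domain) :
    rank (I.pos i v) ≤ rank (I.pos j v) := by
  induction j, hij using Nat.le_induction with
  | base => exact le_rfl
  | succ j hij ih => exact (ih (by omega)).trans (rank_pos_le_succ (by omega) hv)

/-- Ranks never decrease along a path, so equal ranks force every step in between to have length
zero. -/
theorem pos_eq_of_rank_eq (hij : i ≤ j) (hj : j ≤ I.len) (hv : v ∈ I.domain)
    (h : rank (I.pos i v) = rank (I.pos j v)) : I.pos i v = I.pos j v := by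
  induction j, hij using Nat.le_induction with
  | base => rfl
  | succ j hij ih =>
    have h1 := rank_pos_le hij (by omega) hv
    have h2 := rank_pos_le_succ (by omega : j < I.len) hv
    rw [ih (by omega) (by linarith), pos_succ (by omega) hv,
      show rank (I.pos (j + 1) v) - rank (I.pos j v) = 0 by linarith]
    simp

theorem Seg.pos_left (hi : i < I.len) (hv : v ∈ I.domain) : I.Seg i v (I.pos i v) :=
  ⟨by simp, le_rfl, rank_pos_le_succ hi hv⟩

theorem Seg.pos_right (hi : i < I.len) (hv : v ∈ I.domain) : I.Seg i v (I.pos (i + 1) v) :=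
  ⟨pos_succ hi hv, rank_pos_le_succ hi hv, le_rfl⟩

theorem Seg.eq_pos_left (hx : I.Seg i v x) (h : rank x = rank (I.pos i v)) : x = I.pos i v := by
  rw [hx.1, h, sub_self, zero_smul, add_zero]

theorem Seg.eq_pos_right (hx : I.Seg i v x) (hi : i < I.len) (hv : v ∈ I.domain)
    (h : rank x = rank (I.pos (i + 1) v)) : x = I.pos (i + 1) v := by
  rw [hx.1, h]
  exact (pos_succ hi hv).symm

theorem Seg.inv_eq (hx : I.Seg i v x) (hi : i < I.len) (hv : v ∈ I.domain) : I.inv i x = v := by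
  rw [hx.1, I.inv_add i hi, I.inv_pos i hi v hv]

/-- A point that lies on two segments of the same path. -/
theorem Seg.eq_of_lt (hx : I.Seg i v x) (hy : I.Seg j v y) (hij : i < j) (hj : j < I.len)
    (hv : v ∈ I.domain) (h : rank y ≤ rank x) :
    x = y ∧ ∀ k, i < k → k ≤ j → x = I.pos k v := by
  have h0 := rank_pos_le (by omega : i + 1 ≤ j) hj.le hv
  -- The chain rank of `x` ≤ rank of `pos (i + 1)` ≤ rank of `pos j` ≤ rank of `y` ≤ rank of `x`
  -- collapses.
  have h1 : rank x = rank (I.pos (i + 1) v) := le_antisymm hx.2.2 (by linarith [hy.2.1])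
  have h2 : rank y = rank (I.pos j v) := le_antisymm (by linarith [hx.2.2]) hy.2.1
  have h3 := hx.eq_pos_right (by omega) hv h1
  have h4 : ∀ k, i < k → k ≤ j → x = I.pos k v := by
    intro k hk hkj
    have h5 := rank_pos_le (by omega : i + 1 ≤ k) (by omega) hv
    have h6 := rank_pos_le hkj hj.le hv
    rw [h3]
    exact pos_eq_of_rank_eq (by omega) (by omega) hv (by linarith)
  exact ⟨(h4 j hij le_rfl).trans (hy.eq_pos_left h2).symm, h4⟩

/-- The rank parametrises a path, so statements about points of hooks reduce to inequalities between
ranks. -/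
theorem Seg.eq_of_rank_eq (hx : I.Seg i v x) (hy : I.Seg j v y) (hi : i < I.len) (hj : j < I.len)
    (hv : v ∈ I.domain) (h : rank x = rank y) : x = y := by
  rcases lt_trichotomy i j with hij | rfl | hij
  · exact (hx.eq_of_lt hy hij hj hv h.ge).1
  · rw [hx.1, hy.1, h]
  · exact (hy.eq_of_lt hx hij hi hv h.le).1.symm

theorem On.rank_bounds (hx : I.On v x) (hv : v ∈ I.domain) :
    rank (I.pos 0 v) ≤ rank x ∧ rank x ≤ rank (I.pos I.len v) := by
  obtain ⟨i, hi, h⟩ := hx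
  exact ⟨(rank_pos_le (Nat.zero_le i) hi.le hv).trans h.2.1,
    h.2.2.trans (rank_pos_le (by omega) le_rfl hv)⟩

/-- A discrete intermediate value argument, which needs no monotonicity and hence no `v ∈ I.domain`.
-/
theorem exists_rank_between {r : ℝ} (h0 : rank (I.pos 0 v) ≤ r)
    (h1 : r ≤ rank (I.pos I.len v)) :
    ∃ i < I.len, rank (I.pos i v) ≤ r ∧ r ≤ rank (I.pos (i + 1) v) := by
  by_contra! h
  have key : ∀ i, i ≤ I.len → rank (I.pos i v) ≤ r := by
    intro i
    induction i with
    | zero => exact fun _ => h0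
    | succ i ih => exact fun hi => (h i hi (ih (by omega))).le
  obtain ⟨n, hn⟩ := Nat.exists_eq_succ_of_ne_zero I.len_pos.ne'
  have := h n (by omega) (key n (by omega))
  rw [hn] at h1
  exact absurd h1 (not_le.2 this)

end Itinerary

/-- The set `P` is partitioned into the paths of the given itineraries (without the end points, if
`fake` holds), and these paths are symmetric with respect to the rank `R`. -/
structure IsSweep {α τ ι : Type*} [Fintype τ] [Fintype ι] [DecidableEq ι] (fake : Prop)
    (P : Set (ι → ℝ)) (R : ℝ) (I : α → Itinerary τ ι) : Prop where
  mem : ∀ a, ∀ v ∈ (I a).domain, ∀ x, (I a).Inside fake v x → x ∈ P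
  exists_mem : ∀ x ∈ P, ∃ a, ∃ v ∈ (I a).domain, (I a).Inside fake v x
  unique : ∀ a a', ∀ v ∈ (I a).domain, ∀ v' ∈ (I a').domain, ∀ x, (I a).Inside fake v x →
    (I a').Inside fake v' x → a = a' ∧ v = v'
  symmetric : ∀ a, ∀ v ∈ (I a).domain,
    rank ((I a).pos 0 v) + rank ((I a).pos (I a).len v) = R

end Itinerary

/-! ### Construction of hooks in a product of two paths. -/

section Hook

variable {τ σ : Type*}

/-- The first component of the parameter `(a, b, t)` of a hook in a product of two paths. -/
def hookFst (v : (τ ⊕ σ) ⊕ Unit → ℝ) : τ → ℝ := fun i => v (Sum.inl (Sum.inl i))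

/-- The second component of the parameter `(a, b, t)` of a hook in a product of two paths. -/
def hookSnd (v : (τ ⊕ σ) ⊕ Unit → ℝ) : σ → ℝ := fun i => v (Sum.inl (Sum.inr i))

/-- The third component of the parameter `(a, b, t)` of a hook in a product of two paths. -/
def hookTime (v : (τ ⊕ σ) ⊕ Unit → ℝ) : ℝ := v (Sum.inr ())

/-- The parameter `(a, b, t)` of a hook in a product of two paths. -/
def hookMk (a : τ → ℝ) (b : σ → ℝ) (t : ℝ) : (τ ⊕ σ) ⊕ Unit → ℝ :=
  Sum.elim (Sum.elim a b) fun _ => t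

theorem hookMk_eta (v : (τ ⊕ σ) ⊕ Unit → ℝ) : hookMk (hookFst v) (hookSnd v) (hookTime v) = v := by
  ext ((i | i) | i) <;> rfl

theorem IntAffineMap.hookMk {γ : Type*} [Fintype γ] {f : (γ → ℝ) → τ → ℝ} {g : (γ → ℝ) → σ → ℝ}
    {t : (γ → ℝ) → ℝ} (hf : IntAffineMap f) (hg : IntAffineMap g) (ht : IntAffine t) :
    IntAffineMap fun x => SnakeDecomposition.hookMk (f x) (g x) (t x) :=
  IntAffineMap.sumElim (IntAffineMap.sumElim hf hg) fun _ => ht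

theorem sumElim_add_single_inl {ι κ : Type*} [DecidableEq ι] [DecidableEq κ] (x : ι → ℝ)
    (y : κ → ℝ) (s : ℝ) (d : ι) :
    (Sum.elim x y + s • (Pi.single (Sum.inl d) 1 : ι ⊕ κ → ℝ) : ι ⊕ κ → ℝ) =
      Sum.elim (x + s • (Pi.single d 1 : ι → ℝ)) y := by
  ext (i | i) <;> simp [Pi.single_apply]

theorem sumElim_add_single_inr {ι κ : Type*} [DecidableEq ι] [DecidableEq κ] (x : ι → ℝ)
    (y : κ → ℝ) (s : ℝ) (d : κ) :
    (Sum.elim x y + s • (Pi.single (Sum.inr d) 1 : ι ⊕ κ → ℝ) : ι ⊕ κ → ℝ) =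
      Sum.elim x (y + s • (Pi.single d 1 : κ → ℝ)) := by
  ext (i | i) <;> simp [Pi.single_apply]

namespace Itinerary

/-- The first component of the corner of a hook, if it lies on the `i`-th segment. -/
def hookX {ι : Type*} [Fintype τ] [Fintype ι] [DecidableEq ι] (I : Itinerary τ ι) (i : ℕ)
    (v : (τ ⊕ σ) ⊕ Unit → ℝ) : ι → ℝ :=
  I.pos i (hookFst v) + (rank (I.pos I.len (hookFst v)) - hookTime v - rank (I.pos i (hookFst v))) •
    (Pi.single (I.dir i) 1 : ι → ℝ)

/-- The second component of the corner of a hook, if it lies on the `j`-th segment. -/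
def hookY {κ : Type*} [Fintype σ] [Fintype κ] [DecidableEq κ] (J : Itinerary σ κ) (j : ℕ)
    (v : (τ ⊕ σ) ⊕ Unit → ℝ) : κ → ℝ :=
  J.pos j (hookSnd v) + (rank (J.pos 0 (hookSnd v)) + hookTime v - rank (J.pos j (hookSnd v))) •
    (Pi.single (J.dir j) 1 : κ → ℝ)

theorem rank_hookX {ι : Type*} [Fintype τ] [Fintype ι] [DecidableEq ι] {I : Itinerary τ ι} {i : ℕ}
    (v : (τ ⊕ σ) ⊕ Unit → ℝ) :
    rank (I.hookX i v) = rank (I.pos I.len (hookFst v)) - hookTime v := by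
  rw [hookX, rank_add_single]
  ring

theorem rank_hookY {κ : Type*} [Fintype σ] [Fintype κ] [DecidableEq κ] {J : Itinerary σ κ} {j : ℕ}
    (v : (τ ⊕ σ) ⊕ Unit → ℝ) :
    rank (J.hookY j v) = rank (J.pos 0 (hookSnd v)) + hookTime v := by
  rw [hookY, rank_add_single]
  ring

end Itinerary

variable [Fintype τ] [Fintype σ]

theorem intAffineMap_hookFst : IntAffineMap (hookFst : ((τ ⊕ σ) ⊕ Unit → ℝ) → τ → ℝ) :=
  fun _ => IntAffine.coord _

theorem intAffineMap_hookSnd : IntAffineMap (hookSnd : ((τ ⊕ σ) ⊕ Unit → ℝ) → σ → ℝ) :=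
  fun _ => IntAffine.coord _

theorem intAffine_hookTime : IntAffine (hookTime : ((τ ⊕ σ) ⊕ Unit → ℝ) → ℝ) :=
  IntAffine.coord _

namespace Itinerary

variable {ι κ : Type*} [Fintype ι] [DecidableEq ι] [Fintype κ] [DecidableEq κ]
  (I : Itinerary τ ι) (J : Itinerary σ κ) (i j : ℕ)

/-- The parameters of the hooks such that the two components of the corner lie on the `i`-th and
the `j`-th segment. -/
def hookRegion : Set ((τ ⊕ σ) ⊕ Unit → ℝ) :=
  {v | (rank (I.pos i (hookFst v)) ≤ rank (I.pos I.len (hookFst v)) - hookTime v ∧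
      rank (I.pos I.len (hookFst v)) - hookTime v ≤ rank (I.pos (i + 1) (hookFst v))) ∧
    rank (J.pos j (hookSnd v)) ≤ rank (J.pos 0 (hookSnd v)) + hookTime v ∧
      rank (J.pos 0 (hookSnd v)) + hookTime v ≤ rank (J.pos (j + 1) (hookSnd v))}

/-- The vertices of a hook. -/
def hookPos (l : ℕ) (v : (τ ⊕ σ) ⊕ Unit → ℝ) : ι ⊕ κ → ℝ :=
  -- Vertex `i + 1` is the corner, which stands in for `J.pos j` in the second component; the `m`-th
  -- vertex after it uses `J.pos (j + m)`.
  if l ≤ i then Sum.elim (I.pos l (hookFst v)) (J.hookY j v)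
  else Sum.elim (I.hookX i v)
    (if l = i + 1 then J.hookY j v else J.pos (j + (l - (i + 1))) (hookSnd v))

variable {I J i j}

theorem hookPos_of_le {l : ℕ} (h : l ≤ i) (v : (τ ⊕ σ) ⊕ Unit → ℝ) :
    hookPos I J i j l v = Sum.elim (I.pos l (hookFst v)) (J.hookY j v) :=
  if_pos h

theorem hookPos_corner (v : (τ ⊕ σ) ⊕ Unit → ℝ) :
    hookPos I J i j (i + 1) v = Sum.elim (I.hookX i v) (J.hookY j v) := by
  rw [hookPos, if_neg (by omega), if_pos rfl]

theorem hookPos_add (m : ℕ) (v : (τ ⊕ σ) ⊕ Unit → ℝ) :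
    hookPos I J i j (i + 1 + (m + 1)) v =
      Sum.elim (I.hookX i v) (J.pos (j + (m + 1)) (hookSnd v)) := by
  rw [hookPos, if_neg (by omega), if_neg (by omega), Nat.add_sub_cancel_left]

theorem seg_hookX {v : (τ ⊕ σ) ⊕ Unit → ℝ} (hv : v ∈ hookRegion I J i j) :
    I.Seg i (hookFst v) (I.hookX i v) := by
  rw [Seg, rank_hookX]
  exact ⟨rfl, hv.1⟩

theorem seg_hookY {v : (τ ⊕ σ) ⊕ Unit → ℝ} (hv : v ∈ hookRegion I J i j) :
    J.Seg j (hookSnd v) (J.hookY j v) := by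
  rw [Seg, rank_hookY]
  exact ⟨rfl, hv.2⟩

theorem intAffineMap_hookX (hi : i < I.len) :
    IntAffineMap (I.hookX i : ((τ ⊕ σ) ⊕ Unit → ℝ) → ι → ℝ) :=
  ((I.pos_int i hi.le).comp intAffineMap_hookFst).add_single
    ((((I.pos_int _ le_rfl).comp intAffineMap_hookFst).rank.sub intAffine_hookTime).sub
      ((I.pos_int i hi.le).comp intAffineMap_hookFst).rank) _

theorem intAffineMap_hookY (hj : j < J.len) :
    IntAffineMap (J.hookY j : ((τ ⊕ σ) ⊕ Unit → ℝ) → κ → ℝ) :=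
  ((J.pos_int j hj.le).comp intAffineMap_hookSnd).add_single
    ((((J.pos_int _ (Nat.zero_le _)).comp intAffineMap_hookSnd).rank.add intAffine_hookTime).sub
      ((J.pos_int j hj.le).comp intAffineMap_hookSnd).rank) _

variable (I J i j)

/-- The hooks in the product of two itineraries: the path with parameter `(a, b, t)` starts at the
pair of the first point of the path of `a` and the point at distance `t` on the path of `b`. Its
first component follows the path of `a` as long as the distance from the end is at least `t`, then
its second component follows the path of `b`. -/
def hook (hi : i < I.len) (hj : j < J.len) (D : Set ((τ ⊕ σ) ⊕ Unit → ℝ))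
    (hD : ∀ v ∈ D, hookFst v ∈ I.domain ∧ hookSnd v ∈ J.domain ∧ v ∈ hookRegion I J i j) :
    Itinerary ((τ ⊕ σ) ⊕ Unit) (ι ⊕ κ) where
  domain := D
  -- The segments `0, …, i` of `I`, the last one cut off at the corner, then the segments `j, …,
  -- J.len - 1` of `J`, the first one beginning at the corner.
  len := i + 1 + (J.len - j)
  len_pos := by omega
  dir l := if l ≤ i then Sum.inl (I.dir l) else Sum.inr (J.dir (j + (l - (i + 1))))
  pos := hookPos I J i j
  -- The time is read off the component at rest on the segment: the second one at distance `t` from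
  -- its start, later the first one at distance `t` from its end. Hence `inv` is constant along the
  -- direction of the segment.
  inv l z :=
    if l ≤ i then hookMk (I.inv l (z ∘ Sum.inl)) (J.inv j (z ∘ Sum.inr))
      (rank (z ∘ Sum.inr) - rank (J.pos 0 (J.inv j (z ∘ Sum.inr))))
    else hookMk (I.inv i (z ∘ Sum.inl)) (J.inv (j + (l - (i + 1))) (z ∘ Sum.inr))
      (rank (I.pos I.len (I.inv i (z ∘ Sum.inl))) - rank (z ∘ Sum.inl))
  pos_int l hl := by
    unfold hookPos
    split_ifs with h1 h2
    · exact ((I.pos_int l (by omega)).comp intAffineMap_hookFst).sumElim (intAffineMap_hookY hj)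
    · exact (intAffineMap_hookX hi).sumElim (intAffineMap_hookY hj)
    · exact (intAffineMap_hookX hi).sumElim
        ((J.pos_int _ (by omega)).comp intAffineMap_hookSnd)
  inv_int l hl := by
    have hl : IntAffineMap fun z : ι ⊕ κ → ℝ => z ∘ Sum.inl := IntAffineMap.reindex _
    have hr : IntAffineMap fun z : ι ⊕ κ → ℝ => z ∘ Sum.inr := IntAffineMap.reindex _
    split_ifs with h1
    · exact IntAffineMap.hookMk ((I.inv_int l (by omega)).comp hl) ((J.inv_int j hj).comp hr)
        (hr.rank.sub ((J.pos_int 0 (Nat.zero_le _)).comp ((J.inv_int j hj).comp hr)).rank)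
    · exact IntAffineMap.hookMk ((I.inv_int i hi).comp hl) ((J.inv_int _ (by omega)).comp hr)
        (((I.pos_int _ le_rfl).comp ((I.inv_int i hi).comp hl)).rank.sub hl.rank)
  inv_add l hl z s := by
    obtain ⟨x, y, rfl⟩ : ∃ x y, z = Sum.elim x y :=
      ⟨z ∘ Sum.inl, z ∘ Sum.inr, (Sum.elim_comp_inl_inr z).symm⟩
    split_ifs with h1
    · rw [sumElim_add_single_inl]
      simp only [Sum.elim_comp_inl, Sum.elim_comp_inr]
      rw [I.inv_add l (by omega)]
    · rw [sumElim_add_single_inr]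
      simp only [Sum.elim_comp_inl, Sum.elim_comp_inr]
      rw [J.inv_add _ (by omega)]
  inv_pos l hl v hv := by
    obtain ⟨ha, hb, hr⟩ := hD v hv
    have hX := (seg_hookX hr).inv_eq hi ha
    have hY := (seg_hookY hr).inv_eq hj hb
    unfold hookPos
    split_ifs with h1 h2
    · simp only [Sum.elim_comp_inl, Sum.elim_comp_inr]
      rw [I.inv_pos l (by omega) _ ha, hY, rank_hookY, add_sub_cancel_left, hookMk_eta]
    · subst h2
      simp only [Sum.elim_comp_inl, Sum.elim_comp_inr]
      rw [Nat.sub_self, add_zero, hX, hY, rank_hookX, sub_sub_cancel, hookMk_eta]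
    · simp only [Sum.elim_comp_inl, Sum.elim_comp_inr]
      rw [J.inv_pos _ (by omega) _ hb, hX, rank_hookX, sub_sub_cancel, hookMk_eta]
  step l hl v hv := by
    obtain ⟨ha, hb, hr⟩ := hD v hv
    rcases lt_trichotomy l i with h | rfl | h
    · rw [hookPos_of_le (by omega), hookPos_of_le (by omega), if_pos h.le]
      obtain ⟨s, hs, h⟩ := I.step l (by omega) _ ha
      exact ⟨s, hs, by rw [sumElim_add_single_inl, h]⟩
    · rw [hookPos_corner, hookPos_of_le le_rfl, if_pos le_rfl]
      exact ⟨_, sub_nonneg.2 hr.1.1, by rw [sumElim_add_single_inl, hookX]⟩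
    · obtain ⟨m, rfl⟩ : ∃ m, l = i + 1 + m := ⟨l - (i + 1), by omega⟩
      rw [add_assoc (i + 1) m 1, hookPos_add, if_neg (by omega), Nat.add_sub_cancel_left]
      rcases m with _ | m
      · rw [add_zero, hookPos_corner]
        -- The step from the corner covers only the rest of segment `j`.
        refine ⟨rank (J.pos (j + 1) (hookSnd v)) - rank (J.hookY j v),
          sub_nonneg.2 (seg_hookY hr).2.2, ?_⟩
        rw [sumElim_add_single_inr, add_zero]
        congr 1
        conv_lhs => rw [zero_add, pos_succ hj hb]
        rw [rank_hookY, hookY, add_assoc, ← add_smul]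
        congr 2
        ring
      · rw [hookPos_add]
        obtain ⟨s, hs, h⟩ := J.step (j + (m + 1)) (by omega) _ hb
        exact ⟨s, hs, by rw [sumElim_add_single_inr, ← h, ← add_assoc j]⟩

end Itinerary

end Hook

/-! ### The points of a hook in terms of ranks. -/

section Hook

theorem sumElim_inj {ι κ : Type*} {x x' : ι → ℝ} {y y' : κ → ℝ} :
    (Sum.elim x y : ι ⊕ κ → ℝ) = Sum.elim x' y' ↔ x = x' ∧ y = y' := by
  constructor
  · intro h
    exact ⟨funext fun i => congrFun h (Sum.inl i), funext fun i => congrFun h (Sum.inr i)⟩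
  · rintro ⟨rfl, rfl⟩
    rfl

namespace Itinerary

variable {τ σ ι κ : Type*} [Fintype τ] [Fintype σ] [Fintype ι] [DecidableEq ι] [Fintype κ]
  [DecidableEq κ] {I : Itinerary τ ι} {J : Itinerary σ κ} {i j : ℕ}
  {hi : i < I.len} {hj : j < J.len} {D : Set ((τ ⊕ σ) ⊕ Unit → ℝ)}
  {hD : ∀ v ∈ D, hookFst v ∈ I.domain ∧ hookSnd v ∈ J.domain ∧ v ∈ hookRegion I J i j}
  {v : (τ ⊕ σ) ⊕ Unit → ℝ} {x : ι → ℝ} {y : κ → ℝ}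

/-- The bound by the corner matters only for `l = i`; for smaller `l` it is automatic, since the
ranks increase. This is the minimum in `hsucc`. -/
theorem hook_seg_of_le (hv : v ∈ D) {l : ℕ} (hl : l ≤ i) :
    (hook I J i j hi hj D hD).Seg l v (Sum.elim x y) ↔
      I.Seg l (hookFst v) x ∧ rank x ≤ rank (I.hookX i v) ∧ y = J.hookY j v := by
  obtain ⟨ha, hb, hr⟩ := hD v hv
  have hpos : (hook I J i j hi hj D hD).pos l v
      = Sum.elim (I.pos l (hookFst v)) (J.hookY j v) := hookPos_of_le hl v
  have hdir : (hook I J i j hi hj D hD).dir l = Sum.inl (I.dir l) := if_pos hl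
  rw [Seg, Seg, hpos, hdir, sumElim_add_single_inl, sumElim_inj, rank_sumElim, rank_sumElim]
  have hsucc : rank ((hook I J i j hi hj D hD).pos (l + 1) v)
      = min (rank (I.pos (l + 1) (hookFst v))) (rank (I.hookX i v)) + rank (J.hookY j v) := by
    rcases hl.lt_or_eq with hl | rfl
    · have : (hook I J i j hi hj D hD).pos (l + 1) v
        = Sum.elim (I.pos (l + 1) (hookFst v)) (J.hookY j v) := hookPos_of_le hl v
      rw [this, rank_sumElim, min_eq_left]
      exact (rank_pos_le (by omega) hi.le ha).trans (seg_hookX hr).2.1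
    · have : (hook I J l j hi hj D hD).pos (l + 1) v
        = Sum.elim (I.hookX l v) (J.hookY j v) := hookPos_corner v
      rw [this, rank_sumElim, min_eq_right (seg_hookX hr).2.2]
  rw [hsucc]
  constructor
  · rintro ⟨⟨h1, rfl⟩, h2, h3⟩
    rw [add_sub_add_right_eq_sub] at h1
    have h3 := le_min_iff.1 (le_of_add_le_add_right h3)
    exact ⟨⟨h1, le_of_add_le_add_right h2, h3.1⟩, h3.2, rfl⟩
  · rintro ⟨⟨h1, h2, h3⟩, h4, rfl⟩
    rw [add_sub_add_right_eq_sub]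
    exact ⟨⟨h1, rfl⟩, by gcongr, by gcongr; exact le_min h3 h4⟩

theorem hook_seg_add (hv : v ∈ D) {m : ℕ} (hm : j + m < J.len) :
    (hook I J i j hi hj D hD).Seg (i + 1 + m) v (Sum.elim x y) ↔
      x = I.hookX i v ∧ J.Seg (j + m) (hookSnd v) y ∧ rank (J.hookY j v) ≤ rank y := by
  obtain ⟨ha, hb, hr⟩ := hD v hv
  have hY := seg_hookY hr
  have hsucc : (hook I J i j hi hj D hD).pos (i + 1 + m + 1) v
      = Sum.elim (I.hookX i v) (J.pos (j + (m + 1)) (hookSnd v)) := hookPos_add m v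
  have hdir : (hook I J i j hi hj D hD).dir (i + 1 + m) = Sum.inr (J.dir (j + m)) :=
    (if_neg (by omega)).trans (by rw [Nat.add_sub_cancel_left])
  rw [Seg, Seg, hsucc, hdir, add_assoc j m 1]
  rcases m with _ | m
  · have hpos : (hook I J i j hi hj D hD).pos (i + 1 + 0) v
      = Sum.elim (I.hookX i v) (J.hookY j v) := hookPos_corner v
    rw [hpos, sumElim_add_single_inr, sumElim_inj, rank_sumElim, rank_sumElim, rank_sumElim]
    simp only [add_zero, zero_add]
    -- The corner and `J.pos j` lie on one line in direction `J.dir j`, so moving from either to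
    -- rank `s` gives the same point.
    have hmove : ∀ s, J.hookY j v + (s - rank (J.hookY j v)) • (Pi.single (J.dir j) 1 : κ → ℝ)
        = J.pos j (hookSnd v) + (s - rank (J.pos j (hookSnd v))) •
          (Pi.single (J.dir j) 1 : κ → ℝ) := by
      intro s
      conv_lhs => rw [hY.1]
      rw [rank_add_single, add_assoc, ← add_smul]
      congr 2
      ring
    constructor
    · rintro ⟨⟨rfl, h1⟩, h2, h3⟩
      rw [add_sub_add_left_eq_sub, hmove] at h1
      have h2 := le_of_add_le_add_left h2
      exact ⟨rfl, ⟨h1, hY.2.1.trans h2, le_of_add_le_add_left h3⟩, h2⟩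
    · rintro ⟨rfl, ⟨h1, h2, h3⟩, h4⟩
      rw [add_sub_add_left_eq_sub, hmove]
      exact ⟨⟨rfl, h1⟩, by gcongr, by gcongr⟩
  · have hpos : (hook I J i j hi hj D hD).pos (i + 1 + (m + 1)) v
      = Sum.elim (I.hookX i v) (J.pos (j + (m + 1)) (hookSnd v)) := hookPos_add m v
    rw [hpos, sumElim_add_single_inr, sumElim_inj, rank_sumElim, rank_sumElim, rank_sumElim]
    have hle : rank (J.hookY j v) ≤ rank (J.pos (j + (m + 1)) (hookSnd v)) :=
      hY.2.2.trans (rank_pos_le (by omega) hm.le hb)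
    constructor
    · rintro ⟨⟨rfl, h1⟩, h2, h3⟩
      rw [add_sub_add_left_eq_sub] at h1
      have h2 := le_of_add_le_add_left h2
      exact ⟨rfl, ⟨h1, h2, le_of_add_le_add_left h3⟩, hle.trans h2⟩
    · rintro ⟨rfl, ⟨h1, h2, h3⟩, h4⟩
      rw [add_sub_add_left_eq_sub]
      exact ⟨⟨rfl, h1⟩, by gcongr, by gcongr⟩

/-- In the product of the two chains a hook is an L-shape described by ranks alone; the segments
containing `x` and `y` no longer matter. -/
theorem hook_on_iff (hv : v ∈ D) : (hook I J i j hi hj D hD).On v (Sum.elim x y) ↔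
    I.On (hookFst v) x ∧ J.On (hookSnd v) y ∧
      (rank y = rank (J.hookY j v) ∧ rank x ≤ rank (I.hookX i v) ∨
        rank x = rank (I.hookX i v) ∧ rank (J.hookY j v) ≤ rank y) := by
  obtain ⟨ha, hb, hr⟩ := hD v hv
  have hX := seg_hookX hr
  have hY := seg_hookY hr
  have hlen : (hook I J i j hi hj D hD).len = i + 1 + (J.len - j) := rfl
  constructor
  · rintro ⟨l, hl, h⟩
    rw [hlen] at hl
    rcases le_or_gt l i with hli | hli
    · obtain ⟨h1, h2, rfl⟩ := (hook_seg_of_le hv hli).1 h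
      exact ⟨⟨l, by omega, h1⟩, ⟨j, hj, hY⟩, Or.inl ⟨rfl, h2⟩⟩
    · obtain ⟨m, rfl⟩ : ∃ m, l = i + 1 + m := ⟨l - (i + 1), by omega⟩
      obtain ⟨rfl, h1, h2⟩ := (hook_seg_add hv (by omega)).1 h
      exact ⟨⟨i, hi, hX⟩, ⟨j + m, by omega, h1⟩, Or.inr ⟨rfl, h2⟩⟩
  · rintro ⟨⟨l, hl, hx⟩, ⟨k, hk, hy⟩, ⟨h1, h2⟩ | ⟨h1, h2⟩⟩
    · have hyY := hy.eq_of_rank_eq hY hk hj hb h1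
      rcases le_or_gt l i with hli | hli
      · exact ⟨l, by rw [hlen]; omega, (hook_seg_of_le hv hli).2 ⟨hx, h2, hyY⟩⟩
      · have hxX := (hX.eq_of_lt hx hli hl ha h2).1
        rw [← hxX]
        exact ⟨i, by rw [hlen]; omega, (hook_seg_of_le hv le_rfl).2 ⟨hX, le_rfl, hyY⟩⟩
    · have hxX := hx.eq_of_rank_eq hX hl hi ha h1
      rcases le_or_gt j k with hjk | hjk
      · obtain ⟨m, rfl⟩ : ∃ m, k = j + m := ⟨k - j, by omega⟩
        exact ⟨i + 1 + m, by rw [hlen]; omega, (hook_seg_add hv hk).2 ⟨hxX, hy, h2⟩⟩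
      · have hyY := (hy.eq_of_lt hY hjk hj hb h2).1
        rw [hyY]
        exact ⟨i + 1 + 0, by rw [hlen]; omega,
          (hook_seg_add hv (m := 0) (by omega)).2 ⟨hxX, hY, le_rfl⟩⟩

theorem rank_hook_pos_zero : rank ((hook I J i j hi hj D hD).pos 0 v)
    = rank (I.pos 0 (hookFst v)) + (rank (J.pos 0 (hookSnd v)) + hookTime v) := by
  have : (hook I J i j hi hj D hD).pos 0 v = _ := hookPos_of_le (Nat.zero_le i) v
  rw [this, rank_sumElim, rank_hookY]

theorem rank_hook_pos_len :
    rank ((hook I J i j hi hj D hD).pos (hook I J i j hi hj D hD).len v)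
      = rank (I.pos I.len (hookFst v)) - hookTime v + rank (J.pos J.len (hookSnd v)) := by
  have hlen : (hook I J i j hi hj D hD).len = i + 1 + ((J.len - j - 1) + 1) := by
    change i + 1 + (J.len - j) = _
    omega
  have : (hook I J i j hi hj D hD).pos (i + 1 + ((J.len - j - 1) + 1)) v = _ :=
    hookPos_add (J.len - j - 1) v
  rw [hlen, this, rank_sumElim, rank_hookX, show j + (J.len - j - 1 + 1) = J.len by omega]

end Itinerary

end Hook

/-! ### Sweeping a product by hooks. -/

section ProductSweep

variable {τ σ ι κ : Type*} [Fintype τ] [Fintype σ] [Fintype ι] [DecidableEq ι] [Fintype κ]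
  [DecidableEq κ]

theorem IsSweep.comp_equiv {α γ : Type*} {fake : Prop} {P : Set (ι → ℝ)} {R : ℝ}
    {I : α → Itinerary τ ι} (h : IsSweep fake P R I) (e : γ ≃ α) :
    IsSweep fake P R fun c => I (e c) where
  mem c := h.mem (e c)
  exists_mem x hx := by
    obtain ⟨a, v, hv, hx⟩ := h.exists_mem x hx
    exact ⟨e.symm a, v, by rwa [e.apply_symm_apply], by rwa [e.apply_symm_apply]⟩
  unique c c' v hv v' hv' x hx hx' := by
    obtain ⟨h1, h2⟩ := h.unique _ _ v hv v' hv' x hx hx'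
    exact ⟨e.injective h1, h2⟩
  symmetric c := h.symmetric (e c)

theorem _root_.Bornology.IsBounded.image_continuous {E F : Type*} [PseudoMetricSpace E]
    [ProperSpace E] [PseudoMetricSpace F] {s : Set E} (hs : Bornology.IsBounded s) {f : E → F}
    (hf : Continuous f) : Bornology.IsBounded (f '' s) :=
  (hs.isCompact_closure.image hf).isBounded.subset (Set.image_mono subset_closure)

theorem IntAffine.continuous {f : (τ → ℝ) → ℝ} (hf : IntAffine f) : Continuous f := by
  obtain ⟨g, hg⟩ := hf.exists_affineMap
  rw [← funext hg]
  exact g.continuous_of_finiteDimensional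

theorem IntAffine.signDetermined_le {f g : (τ → ℝ) → ℝ} (hf : IntAffine f) (hg : IntAffine g) :
    SignDetermined {x | f x ≤ g x} := by
  obtain ⟨h, hh⟩ := (hg.sub hf).exists_affineMap
  simpa [hh] using signDetermined_nonneg h

theorem IntAffine.signDetermined_lt {f g : (τ → ℝ) → ℝ} (hf : IntAffine f) (hg : IntAffine g) :
    SignDetermined {x | f x < g x} := by
  obtain ⟨h, hh⟩ := (hg.sub hf).exists_affineMap
  simpa [hh] using signDetermined_pos h

theorem IntAffineMap.signDetermined_preimage {ω : Type*} {f : (τ → ℝ) → (ω → ℝ)} (hf : IntAffineMap f)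
    {X : Set (ω → ℝ)} (hX : SignDetermined X) : SignDetermined {x | f x ∈ X} := by
  obtain ⟨h, hh⟩ := hf.exists_affineMap
  have : {x | f x ∈ X} = h ⁻¹' X := by
    ext x
    simp [hh]
  rw [this]
  exact hX.preimage h

namespace Itinerary

variable (I : Itinerary τ ι) (J : Itinerary σ κ)

/-- The parameters of the hooks in the product of two families of paths. -/
def hookParams (fake : Prop) : Set ((τ ⊕ σ) ⊕ Unit → ℝ) :=
  {v | hookFst v ∈ I.domain ∧ hookSnd v ∈ J.domain ∧
    (0 ≤ hookTime v ∧ hookTime v ≤ I.length (hookFst v) ∧ hookTime v ≤ J.length (hookSnd v)) ∧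
    (fake →
      0 < hookTime v ∧ hookTime v < I.length (hookFst v) ∧ hookTime v < J.length (hookSnd v))}

variable {I J} {fake : Prop}

theorem hookMk_mem_hookParams {a : τ → ℝ} {b : σ → ℝ} {t : ℝ} :
    hookMk a b t ∈ I.hookParams J fake ↔ a ∈ I.domain ∧ b ∈ J.domain ∧
      (0 ≤ t ∧ t ≤ rank (I.pos I.len a) - rank (I.pos 0 a) ∧
        t ≤ rank (J.pos J.len b) - rank (J.pos 0 b)) ∧
      (fake → 0 < t ∧ t < rank (I.pos I.len a) - rank (I.pos 0 a) ∧
        t < rank (J.pos J.len b) - rank (J.pos 0 b)) :=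
  Iff.rfl

theorem isBounded_hookParams (hI : Bornology.IsBounded I.domain)
    (hJ : Bornology.IsBounded J.domain) : Bornology.IsBounded (I.hookParams J fake) := by
  have hlen : Continuous I.length :=
    ((I.pos_int _ le_rfl).rank.sub (I.pos_int 0 (Nat.zero_le _)).rank).continuous
  obtain ⟨A, hA⟩ := hI.exists_norm_le
  obtain ⟨B, hB⟩ := hJ.exists_norm_le
  obtain ⟨C, hC⟩ := (hI.image_continuous hlen).exists_norm_le
  refine isBounded_iff_forall_norm_le.2 ⟨max A (max B C), fun v hv => ?_⟩
  obtain ⟨ha, hb, ⟨h0, h1, -⟩, -⟩ := hv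
  have hA' := hA _ ha
  have hB' := hB _ hb
  have hC' := hC _ (Set.mem_image_of_mem _ ha)
  rw [pi_norm_le_iff_of_nonneg ((norm_nonneg _).trans (hA'.trans (le_max_left _ _)))]
  rintro ((i | i) | i)
  · exact (norm_le_pi_norm (hookFst v) i).trans (hA'.trans (le_max_left _ _))
  · exact (norm_le_pi_norm (hookSnd v) i).trans
      (hB'.trans ((le_max_left _ _).trans (le_max_right _ _)))
  · refine le_trans ?_ ((le_max_right B C).trans (le_max_right _ _))
    refine le_trans ?_ ((Real.le_norm_self _).trans hC')
    change ‖hookTime v‖ ≤ _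
    rwa [Real.norm_of_nonneg h0]

theorem signDetermined_hookParams_inter_hookRegion (hI : SignDetermined I.domain)
    (hJ : SignDetermined J.domain) {i j : ℕ} (hi : i < I.len) (hj : j < J.len) :
    SignDetermined (I.hookParams J fake ∩ I.hookRegion J i j) := by
  have hF := fun i hi => ((I.pos_int i hi).comp (intAffineMap_hookFst (σ := σ))).rank
  have hS := fun j hj => ((J.pos_int j hj).comp (intAffineMap_hookSnd (τ := τ))).rank
  have hT := intAffine_hookTime (τ := τ) (σ := σ)
  have hlF := (hF _ le_rfl).sub (hF 0 (Nat.zero_le _))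
  have hlS := (hS _ le_rfl).sub (hS 0 (Nat.zero_le _))
  have hfake : SignDetermined {v : (τ ⊕ σ) ⊕ Unit → ℝ | fake →
      0 < hookTime v ∧ hookTime v < I.length (hookFst v) ∧
        hookTime v < J.length (hookSnd v)} := by
    by_cases h : fake
    · simp only [h, true_imp_iff]
      exact (IntAffine.zero.signDetermined_lt hT).inter
        ((hT.signDetermined_lt hlF).inter (hT.signDetermined_lt hlS))
    · simp only [h, false_imp_iff]
      exact signDetermined_univ
  have hend := (hF _ le_rfl).sub hT
  have hstart := (hS 0 (Nat.zero_le _)).add hT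
  exact ((intAffineMap_hookFst.signDetermined_preimage hI).inter
    ((intAffineMap_hookSnd.signDetermined_preimage hJ).inter
      (((IntAffine.zero.signDetermined_le hT).inter
        ((hT.signDetermined_le hlF).inter (hT.signDetermined_le hlS))).inter hfake))).inter
    ((((hF i hi.le).signDetermined_le hend).inter
        (hend.signDetermined_le (hF (i + 1) hi))).inter
      (((hS j hj.le).signDetermined_le hstart).inter
        (hstart.signDetermined_le (hS (j + 1) hj))))

/-- For a time between 0 and both lengths, each corner component has a rank between those of the
ends of its path. The regions overlap where a corner is a turning point, so they only cover the
parameters. -/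
theorem iUnion_hookParams_inter_hookRegion :
    ⋃ p : Fin I.len × Fin J.len, I.hookParams J fake ∩ I.hookRegion J p.1 p.2
      = I.hookParams J fake := by
  refine subset_antisymm (Set.iUnion_subset fun p => Set.inter_subset_left) fun v hv => ?_
  obtain ⟨-, -, ⟨h0, h1, h2⟩, -⟩ := id hv
  rw [length] at h1 h2
  obtain ⟨i, hi, h3⟩ := exists_rank_between (I := I) (v := hookFst v)
    (r := rank (I.pos I.len (hookFst v)) - hookTime v) (by linarith) (by linarith)
  obtain ⟨j, hj, h4⟩ := exists_rank_between (I := J) (v := hookSnd v)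
    (r := rank (J.pos 0 (hookSnd v)) + hookTime v) (by linarith) (by linarith)
  exact Set.mem_iUnion.2 ⟨(⟨i, hi⟩, ⟨j, hj⟩), hv, h3, h4⟩

/-- If `fake` holds, the strict bounds on the time keep the corner off all ends of the two paths. A
point of the hook then has a component at an end of its path only if it is itself an end of the
hook. -/
theorem hook_inside_iff {i j : ℕ} {hi : i < I.len} {hj : j < J.len}
    {D : Set ((τ ⊕ σ) ⊕ Unit → ℝ)}
    {hD : ∀ v ∈ D, hookFst v ∈ I.domain ∧ hookSnd v ∈ J.domain ∧ v ∈ hookRegion I J i j}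
    (hD' : D ⊆ I.hookParams J fake) {v : (τ ⊕ σ) ⊕ Unit → ℝ} (hv : v ∈ D) {x : ι → ℝ}
    {y : κ → ℝ} :
    (hook I J i j hi hj D hD).Inside fake v (Sum.elim x y) ↔
      I.Inside fake (hookFst v) x ∧ J.Inside fake (hookSnd v) y ∧
      (rank y = rank (J.pos 0 (hookSnd v)) + hookTime v ∧
          rank x ≤ rank (I.pos I.len (hookFst v)) - hookTime v ∨
        rank x = rank (I.pos I.len (hookFst v)) - hookTime v ∧
          rank (J.pos 0 (hookSnd v)) + hookTime v ≤ rank y) := by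
  rw [Inside, hook_on_iff hv, rank_hook_pos_zero, rank_hook_pos_len, rank_sumElim, rank_hookX,
    rank_hookY, Inside, Inside]
  have hf := (hD' hv).2.2.2
  rw [length, length] at hf
  constructor
  · rintro ⟨⟨hx, hy, h⟩, h'⟩
    refine ⟨⟨hx, fun hfake => ?_⟩, ⟨hy, fun hfake => ?_⟩, h⟩
    · obtain ⟨h1, h2⟩ := h' hfake
      obtain ⟨h3, h4, h5⟩ := hf hfake
      rcases h with ⟨h6, h7⟩ | ⟨h6, h7⟩ <;> constructor <;> linarith
    · obtain ⟨h1, h2⟩ := h' hfake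
      obtain ⟨h3, h4, h5⟩ := hf hfake
      rcases h with ⟨h6, h7⟩ | ⟨h6, h7⟩ <;> constructor <;> linarith
  · rintro ⟨⟨hx, hx'⟩, ⟨hy, hy'⟩, h⟩
    refine ⟨⟨hx, hy, h⟩, fun hfake => ?_⟩
    obtain ⟨h1, h2⟩ := hx' hfake
    obtain ⟨h1', h2'⟩ := hy' hfake
    obtain ⟨h3, h4, h5⟩ := hf hfake
    rcases h with ⟨h6, h7⟩ | ⟨h6, h7⟩ <;> constructor <;> linarith

end Itinerary

open Itinerary in
/-- The product of two sets that are swept by symmetric paths is swept by symmetric hooks, the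
parameters of which form relative interiors of simplices. -/
theorem IsSweep.exists_product {α β : Type*} [Finite α] [Finite β] {fake : Prop}
    {P : Set (ι → ℝ)} {Q : Set (κ → ℝ)} {R R' : ℝ} {I : α → Itinerary τ ι}
    {J : β → Itinerary σ κ} (hI : IsSweep fake P R I) (hJ : IsSweep fake Q R' J)
    (hIb : ∀ a, Bornology.IsBounded (I a).domain) (hJb : ∀ b, Bornology.IsBounded (J b).domain)
    (hIs : ∀ a, SignDetermined (I a).domain) (hJs : ∀ b, SignDetermined (J b).domain) :
    ∃ (N : ℕ) (K : Fin N → Itinerary ((τ ⊕ σ) ⊕ Unit) (ι ⊕ κ)),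
      IsSweep fake (product P Q) (R + R') K ∧
      ∀ c, ∃ s : Finset ((τ ⊕ σ) ⊕ Unit → ℝ), s.Nonempty ∧
        AffineIndependent ℝ ((↑) : s → ((τ ⊕ σ) ⊕ Unit → ℝ)) ∧ (K c).domain = openHull s := by
  have key : ∀ p : α × β, ∃ 𝒞, IsSimplexPartition ((I p.1).hookParams (J p.2) fake) 𝒞 ∧
      ∀ s ∈ 𝒞, ∃ q : Fin (I p.1).len × Fin (J p.2).len,
        openHull s ⊆ (I p.1).hookParams (J p.2) fake ∩ (I p.1).hookRegion (J p.2) q.1 q.2 := by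
    intro p
    -- Each part gets a single pair of corner segments, hence hooks of a single combinatorial type.
    have h := exists_isSimplexPartition_subordinate
      (fun q : Fin (I p.1).len × Fin (J p.2).len =>
        (I p.1).hookParams (J p.2) fake ∩ (I p.1).hookRegion (J p.2) q.1 q.2)
      (fun q => signDetermined_hookParams_inter_hookRegion (hIs _) (hJs _) q.1.2 q.2.2)
    rw [iUnion_hookParams_inter_hookRegion] at h
    exact h (isBounded_hookParams (hIb _) (hJb _))
  choose 𝒞 h𝒞 q hq using key
  let K : (Σ p : α × β, 𝒞 p) → Itinerary ((τ ⊕ σ) ⊕ Unit) (ι ⊕ κ) := fun c =>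
    hook (I c.1.1) (J c.1.2) (q c.1 c.2 c.2.2).1 (q c.1 c.2 c.2.2).2 (q c.1 c.2 c.2.2).1.2
      (q c.1 c.2 c.2.2).2.2 (openHull c.2) fun v hv =>
        ⟨(hq _ _ c.2.2 hv).1.1, (hq _ _ c.2.2 hv).1.2.1, (hq _ _ c.2.2 hv).2⟩
  have hK : ∀ c, ∀ v ∈ openHull (c.2 : Finset ((τ ⊕ σ) ⊕ Unit → ℝ)), ∀ x y,
      (K c).Inside fake v (Sum.elim x y) ↔ _ := fun c v hv x y =>
    hook_inside_iff ((hq _ _ c.2.2).trans Set.inter_subset_left) hv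
  have hsweep : IsSweep fake (product P Q) (R + R') K := by
    refine ⟨?_, ?_, ?_, ?_⟩
    · intro c v hv z hz
      obtain ⟨x, y, rfl⟩ : ∃ x y, z = Sum.elim x y :=
        ⟨z ∘ Sum.inl, z ∘ Sum.inr, (Sum.elim_comp_inl_inr z).symm⟩
      obtain ⟨hx, hy, -⟩ := (hK c v hv x y).1 hz
      have hv' := (hq _ _ c.2.2 hv).1
      exact ⟨hI.mem _ _ hv'.1 x hx, hJ.mem _ _ hv'.2.1 y hy⟩
    · intro z hz
      obtain ⟨x, y, rfl⟩ : ∃ x y, z = Sum.elim x y :=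
        ⟨z ∘ Sum.inl, z ∘ Sum.inr, (Sum.elim_comp_inl_inr z).symm⟩
      obtain ⟨i, a, ha, hx⟩ := hI.exists_mem x hz.1
      obtain ⟨j, b, hb, hy⟩ := hJ.exists_mem y hz.2
      have hxb := hx.1.rank_bounds ha
      have hyb := hy.1.rank_bounds hb
      obtain ⟨t, ht, ht'⟩ : ∃ t : ℝ, hookMk a b t ∈ (I i).hookParams (J j) fake ∧
          (rank y = rank ((J j).pos 0 b) + t ∧ rank x ≤ rank ((I i).pos (I i).len a) - t ∨
          rank x = rank ((I i).pos (I i).len a) - t ∧ rank ((J j).pos 0 b) + t ≤ rank y) := by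
        simp only [hookMk_mem_hookParams]
        -- The time is the smaller of these two distances; the comparison tells the leg of the hook.
        rcases le_or_gt (rank y - rank ((J j).pos 0 b)) (rank ((I i).pos (I i).len a) - rank x)
          with h | h
        · refine ⟨rank y - rank ((J j).pos 0 b), ⟨ha, hb, ?_, fun hf => ?_⟩,
            Or.inl ⟨by ring, by linarith⟩⟩
          · refine ⟨?_, ?_, ?_⟩ <;> linarith
          · have h1 := hx.2 hf
            have h2 := hy.2 hf
            refine ⟨?_, ?_, ?_⟩ <;> linarith
        · refine ⟨rank ((I i).pos (I i).len a) - rank x, ⟨ha, hb, ?_, fun hf => ?_⟩,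
            Or.inr ⟨by ring, by linarith⟩⟩
          · refine ⟨?_, ?_, ?_⟩ <;> linarith
          · have h1 := hx.2 hf
            have h2 := hy.2 hf
            refine ⟨?_, ?_, ?_⟩ <;> linarith
      have ht2 := ht
      rw [← (h𝒞 (i, j)).union_eq] at ht2
      obtain ⟨s, hs, hvs⟩ := Set.mem_iUnion₂.1 ht2
      exact ⟨⟨(i, j), s, hs⟩, _, hvs, (hK ⟨(i, j), s, hs⟩ _ hvs x y).2 ⟨hx, hy, ht'⟩⟩
    · rintro ⟨p, s, hs⟩ ⟨p', s', hs'⟩ v hv v' hv' z hz hz'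
      obtain ⟨x, y, rfl⟩ : ∃ x y, z = Sum.elim x y :=
        ⟨z ∘ Sum.inl, z ∘ Sum.inr, (Sum.elim_comp_inl_inr z).symm⟩
      obtain ⟨hx, hy, h⟩ := (hK _ v hv x y).1 hz
      obtain ⟨hx', hy', h'⟩ := (hK _ v' hv' x y).1 hz'
      have hm := (hq _ _ hs hv).1
      have hm' := (hq _ _ hs' hv').1
      obtain ⟨h1, h2⟩ := hI.unique _ _ _ hm.1 _ hm'.1 x hx hx'
      obtain ⟨h3, h4⟩ := hJ.unique _ _ _ hm.2.1 _ hm'.2.1 y hy hy'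
      obtain rfl : p = p' := Prod.ext h1 h3
      -- On either leg the time is the minimum of the same two distances.
      have ht : hookTime v = hookTime v' := by
        simp only [h2, h4] at h h'
        rcases h with ⟨h5, h6⟩ | ⟨h5, h6⟩ <;> rcases h' with ⟨h7, h8⟩ | ⟨h7, h8⟩ <;> linarith
      have hvv : v = v' := by
        rw [← hookMk_eta v, ← hookMk_eta v', h2, h4, ht]
      subst hvv
      refine ⟨?_, rfl⟩
      by_contra hne
      have hss : s ≠ s' := by
        rintro rfl
        exact hne rfl
      exact Set.disjoint_left.1 ((h𝒞 p).disjoint s hs s' hs' hss) hv hv'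
    · intro c v hv
      have hv' := (hq _ _ c.2.2 hv).1
      have h1 := hI.symmetric _ _ hv'.1
      have h2 := hJ.symmetric _ _ hv'.2.1
      have h3 : rank ((K c).pos 0 v) = _ := rank_hook_pos_zero
      have h4 : rank ((K c).pos (K c).len v) = _ := rank_hook_pos_len
      rw [h3, h4]
      linarith
  have : ∀ p, Finite (𝒞 p) := fun p => (h𝒞 p).finite.to_subtype
  obtain ⟨N, ⟨e⟩⟩ := Finite.exists_equiv_fin (Σ p : α × β, 𝒞 p)
  exact ⟨N, _, hsweep.comp_equiv e.symm, fun c =>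
    ⟨(e.symm c).2, (h𝒞 _).nonempty _ (e.symm c).2.2, (h𝒞 _).indep _ (e.symm c).2.2, rfl⟩⟩

end ProductSweep

/-! ### Snake conditions expressed by paths. -/

section Follows

variable {τ ι : Type*} [Fintype τ] [Fintype ι] [DecidableEq ι]

/-- The swipes of the sequence `c` are the families of segments of the itinerary `I`. -/
structure CompatibleSeq.Follows (c : CompatibleSeq ι) (I : Itinerary τ ι) : Prop where
  len_eq : I.len = c.len + 1
  dir_eq : ∀ i, (c.swipe i).dir = I.dir i
  starting_eq : ∀ i, (c.swipe i).starting.carrier = I.pos i '' I.domain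
  ending_eq : ∀ i, (c.swipe i).ending.carrier = I.pos (i + 1) '' I.domain
  move_eq : ∀ i, ∀ v ∈ I.domain, (c.swipe i).move (I.pos i v) = I.pos (i + 1) v

namespace CompatibleSeq.Follows

variable {c : CompatibleSeq ι} {I : Itinerary τ ι} (h : c.Follows I)
include h

theorem lt_len (i : Fin (c.len + 1)) : (i : ℕ) < I.len := by
  rw [h.len_eq]
  exact i.2

theorem mem_swipe_iff {i : Fin (c.len + 1)} {x : ι → ℝ} :
    x ∈ (c.swipe i).carrier ↔ ∃ v ∈ I.domain, I.Seg i v x := by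
  have key : ∀ v ∈ I.domain, x ∈ segment ℝ (I.pos i v) ((c.swipe i).move (I.pos i v)) ↔
      I.Seg i v x := by
    intro v hv
    obtain ⟨s, hs, hstep⟩ := I.step i (h.lt_len i) v hv
    rw [h.move_eq i v hv, segment_eq_image', hstep, Itinerary.Seg, hstep, rank_add_single,
      add_sub_cancel_left]
    constructor
    · rintro ⟨θ, ⟨h0, h1⟩, rfl⟩
      dsimp only
      rw [smul_smul, rank_add_single, add_sub_cancel_left]
      exact ⟨rfl, by nlinarith, by nlinarith⟩
    · rintro ⟨h1, h2, h3⟩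
      rcases hs.eq_or_lt with rfl | hs
      · refine ⟨0, by simp, ?_⟩
        rw [h1, show rank x - rank (I.pos i v) = 0 by linarith]
        simp
      · refine ⟨(rank x - rank (I.pos i v)) / s, ⟨div_nonneg (by linarith) hs.le, ?_⟩, ?_⟩
        · rw [div_le_one hs]
          linarith
        · dsimp only
          rw [smul_smul, div_mul_cancel₀ _ hs.ne', ← h1]
  rw [Swipe.carrier, h.starting_eq, Set.biUnion_image]
  simp only [Set.mem_iUnion, exists_prop]
  exact exists_congr fun v => and_congr_right fun hv => key v hv

/-- Within one swipe `inv i` tells the paths apart, so a point of the path of `v` in the ending set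
can only be that path's own turning point. -/
theorem eq_of_mem_ending {i : Fin (c.len + 1)} {v : τ → ℝ} {x : ι → ℝ} (hv : v ∈ I.domain)
    (hx : I.Seg i v x) (hxe : x ∈ (c.swipe i).ending.carrier) : x = I.pos (i + 1) v := by
  rw [h.ending_eq] at hxe
  obtain ⟨w, hw, rfl⟩ := hxe
  have h1 := hx.inv_eq (h.lt_len i) hv
  rw [(Itinerary.Seg.pos_right (h.lt_len i) hw).inv_eq (h.lt_len i) hw] at h1
  rw [h1]

/-- A path that reaches `x` cannot leave it during a swipe whose ending set contains `x`; so it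
waits at `x`. -/
theorem eq_pos_of_forall_mem_ending {i j : ℕ} {v : τ → ℝ} {x : ι → ℝ} (hv : v ∈ I.domain)
    (hx : x = I.pos i v) (hij : i ≤ j) (hj : j ≤ I.len)
    (hk : ∀ k : Fin (c.len + 1), i ≤ k → k < j → x ∈ (c.swipe k).ending.carrier) :
    x = I.pos j v := by
  induction j, hij using Nat.le_induction with
  | base => exact hx
  | succ j hij ih =>
    have h1 := ih (by omega) fun k hik hkj => hk k hik (by omega)
    have hj' : j < c.len + 1 := by
      rw [← h.len_eq]
      omega
    refine h.eq_of_mem_ending (i := ⟨j, hj'⟩) hv ?_ (hk ⟨j, hj'⟩ hij (Nat.lt_succ_self j))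
    rw [h1]
    exact Itinerary.Seg.pos_left (h.lt_len ⟨j, hj'⟩) hv

/-- Halted means that the path stands still at `x` throughout all earlier or all later swipes, that
is, `x` is one of its end points. -/
theorem halted_iff {i : Fin (c.len + 1)} {v : τ → ℝ} {x : ι → ℝ} (hv : v ∈ I.domain)
    (hx : I.Seg i v x) :
    c.Halted i x ↔ rank x = rank (I.pos 0 v) ∨ rank x = rank (I.pos I.len v) := by
  have hi := h.lt_len i
  refine or_congr ⟨?_, fun hr => ?_⟩ ⟨?_, fun hr => ?_⟩
  · rintro ⟨h1, h2⟩
    have h0 : x ∈ (c.swipe 0).starting.carrier := by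
      rcases (Fin.zero_le i).eq_or_lt with rfl | h3
      · exact h1
      · exact (h2 0 h3).1
    rw [h.starting_eq] at h0
    obtain ⟨w, hw, hwx⟩ := h0
    have h3 := h.eq_pos_of_forall_mem_ending hw hwx.symm (Nat.zero_le i) hi.le
      fun k _ hki => (h2 k hki).2
    -- The path starting at `x` has waited there until swipe `i`, where `inv i` identifies it with
    -- the path of `v`.
    have h4 := hx.inv_eq hi hv
    rw [h3, I.inv_pos i hi w hw] at h4
    rw [← h4, ← hwx]
    rfl
  · have key : ∀ k : ℕ, k ≤ i → x = I.pos k v := by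
      intro k hk
      have h1 := Itinerary.rank_pos_le hk hi.le hv
      have h2 := Itinerary.rank_pos_le (Nat.zero_le k) (by omega) hv
      have h3 := hx.2.1
      rw [hx.eq_pos_left (by linarith)]
      exact (Itinerary.pos_eq_of_rank_eq hk hi.le hv (by linarith)).symm
    rw [h.starting_eq]
    refine ⟨⟨v, hv, (key i le_rfl).symm⟩, fun k hk => ?_⟩
    rw [h.starting_eq, h.ending_eq]
    exact ⟨⟨v, hv, (key k (le_of_lt hk)).symm⟩, ⟨v, hv, (key (k + 1) hk).symm⟩⟩
  · rintro ⟨h1, h2⟩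
    rw [← h.eq_pos_of_forall_mem_ending hv (h.eq_of_mem_ending hv hx h1) (by omega) le_rfl
      fun k hk _ => (h2 k hk).2]
  · have key : ∀ k : ℕ, i + 1 ≤ k → k ≤ I.len → x = I.pos k v := by
      intro k hk hkl
      have h1 := Itinerary.rank_pos_le hk hkl hv
      have h2 := Itinerary.rank_pos_le hkl le_rfl hv
      have h3 := hx.2.2
      rw [hx.eq_pos_right hi hv (by linarith)]
      exact Itinerary.pos_eq_of_rank_eq hk hkl hv (by linarith)
    rw [h.ending_eq]
    refine ⟨⟨v, hv, (key _ le_rfl hi).symm⟩, fun k hk => ?_⟩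
    rw [h.starting_eq, h.ending_eq]
    exact ⟨⟨v, hv, (key k hk (h.lt_len k).le).symm⟩,
      ⟨v, hv, (key (k + 1) (by have : (i : ℕ) < k := hk; omega) (h.lt_len k)).symm⟩⟩

theorem mem_trimmed_iff {i : Fin (c.len + 1)} {x : ι → ℝ} :
    x ∈ c.trimmed i ↔ ∃ v ∈ I.domain, I.Seg i v x ∧
      rank (I.pos 0 v) < rank x ∧ rank x < rank (I.pos I.len v) := by
  have hi := h.lt_len i
  constructor
  · rintro ⟨hx, hh⟩
    obtain ⟨v, hv, hs⟩ := h.mem_swipe_iff.1 hx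
    have hh : ¬ c.Halted i x := hh
    rw [h.halted_iff hv hs, not_or] at hh
    have hb := Itinerary.On.rank_bounds ⟨i, hi, hs⟩ hv
    exact ⟨v, hv, hs, lt_of_le_of_ne hb.1 (Ne.symm hh.1), lt_of_le_of_ne hb.2 hh.2⟩
  · rintro ⟨v, hv, hs, h1, h2⟩
    refine ⟨h.mem_swipe_iff.2 ⟨v, hv, hs⟩, fun hh => ?_⟩
    rcases (h.halted_iff hv hs).1 hh with h3 | h3 <;> linarith

theorem iUnion_swipe : ⋃ i, (c.swipe i).carrier
    = {x | ∃ v ∈ I.domain, I.Inside False v x} := by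
  ext x
  simp only [Set.mem_iUnion, h.mem_swipe_iff]
  constructor
  · rintro ⟨i, v, hv, hs⟩
    exact ⟨v, hv, ⟨i, h.lt_len i, hs⟩, False.elim⟩
  · rintro ⟨v, hv, ⟨i, hi, hs⟩, -⟩
    exact ⟨⟨i, h.len_eq ▸ hi⟩, v, hv, hs⟩

theorem iUnion_trimmed : ⋃ i, c.trimmed i = {x | ∃ v ∈ I.domain, I.Inside True v x} := by
  ext x
  simp only [Set.mem_iUnion, h.mem_trimmed_iff]
  constructor
  · rintro ⟨i, v, hv, hs, hr⟩
    exact ⟨v, hv, ⟨i, h.lt_len i, hs⟩, fun _ => hr⟩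
  · rintro ⟨v, hv, ⟨i, hi, hs⟩, hr⟩
    exact ⟨⟨i, h.len_eq ▸ hi⟩, v, hv, hs, hr trivial⟩

/-- The path of `v` waits at `x` from swipe `i` until swipe `j`, where `inv j` identifies it with
that of `w`. -/
theorem param_eq_of_forall_mem_ending {i j : Fin (c.len + 1)} {v w : τ → ℝ} {x : ι → ℝ}
    (hv : v ∈ I.domain) (hw : w ∈ I.domain) (hxv : I.Seg i v x) (hxw : I.Seg j w x) (hij : i < j)
    (he : ∀ k, i ≤ k → k < j → x ∈ (c.swipe k).ending.carrier) : v = w := by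
  have h1 := h.eq_of_mem_ending hv hxv (he i le_rfl hij)
  have h2 := h.eq_pos_of_forall_mem_ending (j := j) hv h1 hij (h.lt_len j).le
    fun k hik hkj => he k (Nat.le_of_succ_le hik) hkj
  rw [← hxw.inv_eq (h.lt_len j) hw, h2, I.inv_pos j (h.lt_len j) v hv]

/-- The hypothesis `he` is the common part of the real and the fake condition that is needed. -/
theorem param_unique_of_forall {fake : Prop}
    (he : ∀ i j : Fin (c.len + 1), i < j → ∀ x, (∃ v ∈ I.domain, I.Seg i v x ∧ I.Inside fake v x) →
      (∃ v ∈ I.domain, I.Seg j v x ∧ I.Inside fake v x) →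
      ∀ k : Fin (c.len + 1), i ≤ k → k < j → x ∈ (c.swipe k).ending.carrier)
    {v w : τ → ℝ} (hv : v ∈ I.domain) (hw : w ∈ I.domain) {x : ι → ℝ} (hxv : I.Inside fake v x)
    (hxw : I.Inside fake w x) : v = w := by
  obtain ⟨i, hi, hiv⟩ := hxv.1
  obtain ⟨j, hj, hjw⟩ := hxw.1
  lift i to Fin (c.len + 1) using h.len_eq ▸ hi
  lift j to Fin (c.len + 1) using h.len_eq ▸ hj
  rcases lt_trichotomy i j with hij | rfl | hij
  · exact h.param_eq_of_forall_mem_ending hv hw hiv hjw hij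
      (he i j hij x ⟨v, hv, hiv, hxv⟩ ⟨w, hw, hjw, hxw⟩)
  · rw [← hiv.inv_eq hi hv, hjw.inv_eq hi hw]
  · exact (h.param_eq_of_forall_mem_ending hw hv hjw hiv hij
      (he j i hij x ⟨w, hw, hjw, hxw⟩ ⟨v, hv, hiv, hxv⟩)).symm

theorem param_unique_of_real (hc : c.RealCondition) {v w : τ → ℝ} (hv : v ∈ I.domain)
    (hw : w ∈ I.domain) {x : ι → ℝ} (hxv : I.Inside False v x) (hxw : I.Inside False w x) :
    v = w := by
  refine h.param_unique_of_forall ?_ hv hw hxv hxw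
  rintro i j hij x ⟨v, hv, hiv, -⟩ ⟨w, hw, hjw, -⟩ k hik hkj
  obtain ⟨h1, -, h3⟩ := hc i j hij x (h.mem_swipe_iff.2 ⟨v, hv, hiv⟩) (h.mem_swipe_iff.2 ⟨w, hw, hjw⟩)
  rcases hik.eq_or_lt with rfl | hik
  · exact h1
  · exact (h3 k hik hkj).2

theorem param_unique_of_fake (hc : c.FakeCondition) {v w : τ → ℝ} (hv : v ∈ I.domain)
    (hw : w ∈ I.domain) {x : ι → ℝ} (hxv : I.Inside True v x) (hxw : I.Inside True w x) :
    v = w := by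
  refine h.param_unique_of_forall ?_ hv hw hxv hxw
  rintro i j hij x ⟨v, hv, hiv, -, hr⟩ ⟨w, hw, hjw, -, hr'⟩ k hik hkj
  obtain ⟨h1, -, h3⟩ := hc i j hij x (h.mem_trimmed_iff.2 ⟨v, hv, hiv, hr trivial⟩)
    (h.mem_trimmed_iff.2 ⟨w, hw, hjw, hr' trivial⟩)
  rcases hik.eq_or_lt with rfl | hik
  · exact h1.2
  · exact (h3 k hik hkj).2.2

/-- A point common to two swipes lies on a single path, which by monotonicity stands still between
them; so the point is in all turning sets in between. -/
theorem realCondition (hu : ∀ v ∈ I.domain, ∀ w ∈ I.domain, ∀ x, I.Inside False v x →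
    I.Inside False w x → v = w) : c.RealCondition := by
  intro i j hij x hxi hxj
  obtain ⟨v, hv, hiv⟩ := h.mem_swipe_iff.1 hxi
  obtain ⟨w, hw, hjw⟩ := h.mem_swipe_iff.1 hxj
  obtain rfl := hu v hv w hw x ⟨⟨i, h.lt_len i, hiv⟩, False.elim⟩ ⟨⟨j, h.lt_len j, hjw⟩, False.elim⟩
  have key := (hiv.eq_of_lt hjw hij (h.lt_len j) hv le_rfl).2
  simp only [h.starting_eq, h.ending_eq]
  have hij' : (i : ℕ) < j := hij
  refine ⟨⟨v, hv, (key _ (by omega) (by omega)).symm⟩, ⟨v, hv, (key _ hij le_rfl).symm⟩,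
    fun k hik hkj => ?_⟩
  have hkj' : (k : ℕ) < j := hkj
  have hik' : (i : ℕ) < k := hik
  exact ⟨⟨v, hv, (key _ hik hkj'.le).symm⟩, ⟨v, hv, (key _ (by omega) (by omega)).symm⟩⟩

theorem fakeCondition (hu : ∀ v ∈ I.domain, ∀ w ∈ I.domain, ∀ x, I.Inside True v x →
    I.Inside True w x → v = w) : c.FakeCondition := by
  intro i j hij x hxi hxj
  obtain ⟨v, hv, hiv, hr⟩ := h.mem_trimmed_iff.1 hxi
  obtain ⟨w, hw, hjw, hr'⟩ := h.mem_trimmed_iff.1 hxj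
  obtain rfl := hu v hv w hw x ⟨⟨i, h.lt_len i, hiv⟩, fun _ => hr⟩ ⟨⟨j, h.lt_len j, hjw⟩, fun _ => hr'⟩
  have key := (hiv.eq_of_lt hjw hij (h.lt_len j) hv le_rfl).2
  have hij' : (i : ℕ) < j := hij
  refine ⟨⟨hxi, ?_⟩, ⟨hxj, ?_⟩, fun k hik hkj => ?_⟩
  · rw [h.ending_eq]
    exact ⟨v, hv, (key _ (by omega) (by omega)).symm⟩
  · rw [h.starting_eq]
    exact ⟨v, hv, (key _ hij le_rfl).symm⟩
  · have hkj' : (k : ℕ) < j := hkj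
    have hik' : (i : ℕ) < k := hik
    have hxk := key _ hik hkj'.le
    have hk : x ∈ c.trimmed k := by
      refine h.mem_trimmed_iff.2 ⟨v, hv, ?_, hr⟩
      rw [hxk]
      exact Itinerary.Seg.pos_left (h.lt_len k) hv
    rw [h.starting_eq, h.ending_eq]
    exact ⟨⟨hk, v, hv, hxk.symm⟩, ⟨hk, v, hv, (key _ (by omega) (by omega)).symm⟩⟩

/-- A point of a turning set is recovered from its own parameter, and `inv i` ignores motion along
the swipe; so the coordinate in that direction is an integral affine function of the others. -/
theorem inIntegralHyperplane (i : Fin (c.len + 1)) :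
    InIntegralHyperplane (c.swipe i).starting.carrier (c.swipe i).dir ∧
      InIntegralHyperplane (c.swipe i).ending.carrier (c.swipe i).dir := by
  have hi := h.lt_len i
  rw [h.starting_eq, h.ending_eq, h.dir_eq]
  constructor
  · refine inIntegralHyperplane_of_intAffine (f := fun x => I.pos i (I.inv i x) (I.dir i))
      (((I.pos_int i hi.le).comp (I.inv_int i hi)) _) (fun x s => by rw [I.inv_add i hi]) ?_
    rintro _ ⟨v, hv, rfl⟩
    rw [I.inv_pos i hi v hv]
  · refine inIntegralHyperplane_of_intAffine (f := fun x => I.pos (i + 1) (I.inv i x) (I.dir i))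
      (((I.pos_int _ hi).comp (I.inv_int i hi)) _) (fun x s => by rw [I.inv_add i hi]) ?_
    rintro _ ⟨v, hv, rfl⟩
    rw [(Itinerary.Seg.pos_right hi hv).inv_eq hi hv]

end CompatibleSeq.Follows

end Follows

/-! ### Passing between swipe sequences and itineraries. -/

section Existence

variable {τ ι : Type*} [Fintype τ] [Fintype ι] [DecidableEq ι]

/-- A compatible sequence of swipes with turning sets in integral hyperplanes is given by an
itinerary, parametrised by the first turning set. -/
theorem CompatibleSeq.exists_follows (c : CompatibleSeq ι)
    (hc : ∀ i, InIntegralHyperplane (c.swipe i).starting.carrier (c.swipe i).dir ∧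
      InIntegralHyperplane (c.swipe i).ending.carrier (c.swipe i).dir) :
    ∃ I : Itinerary ι ι, I.domain = (c.swipe 0).starting.carrier ∧ c.Follows I := by
  -- Capping the index extends the sequence to all of `ℕ`; the values beyond `c.len` play no role.
  let S : ℕ → Swipe ι := fun i => c.swipe ⟨min i c.len, by omega⟩
  have hS : ∀ i : Fin (c.len + 1), S i = c.swipe i := fun i => by
    exact congrArg c.swipe (Fin.ext (min_eq_left (by omega)))
  have hcomp : ∀ i < c.len, (S i).ending.carrier = (S (i + 1)).starting.carrier := by
    intro i hi
    have h := c.compatible ⟨i, hi⟩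
    rw [← hS, ← hS] at h
    exact h
  choose f hf hfadd hfid using fun i => (hc ⟨min i c.len, by omega⟩).1.exists_projection
  choose g hg hgadd hgid using fun i => (hc ⟨min i c.len, by omega⟩).2.exists_projection
  -- `pos` composes the projections onto the ending hyperplanes, and `back` undoes this by the
  -- projections onto the starting ones.
  let pos : ℕ → (ι → ℝ) → (ι → ℝ) := fun n => Nat.rec (fun x => x) (fun i p x => g i (p x)) n
  let back : ℕ → (ι → ℝ) → (ι → ℝ) := fun n => Nat.rec (fun x => x) (fun i q x => q (f i x)) n
  have hpos_int : ∀ i, IntAffineMap (pos i) := by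
    intro i
    induction i with
    | zero => exact IntAffineMap.id
    | succ i ih => exact (hg i).comp ih
  have hback_int : ∀ i, IntAffineMap (back i) := by
    intro i
    induction i with
    | zero => exact IntAffineMap.id
    | succ i ih => exact ih.comp (hf i)
  -- The projection `g i` ignores motion along the swipe and fixes the ending set, so it agrees with
  -- the shear; this makes the shear integral.
  have hmove : ∀ i, ∀ x ∈ (S i).starting.carrier, (S i).move x = g i x := by
    intro i x hx
    have h := hgid i _ ((S i).bijOn.mapsTo hx)
    rw [hgadd] at h
    exact h.symm
  have himage : ∀ i, g i '' (S i).starting.carrier = (S i).ending.carrier := by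
    intro i
    rw [← (S i).bijOn.image_eq]
    exact Set.image_congr fun x hx => (hmove i x hx).symm
  have hstart : ∀ i ≤ c.len, pos i '' (S 0).starting.carrier = (S i).starting.carrier := by
    intro i
    induction i with
    | zero => exact fun _ => Set.image_id _
    | succ i ih =>
      intro hi
      rw [← hcomp i hi, ← himage, ← ih (by omega), Set.image_image]
  have hmem : ∀ i ≤ c.len, ∀ v ∈ (S 0).starting.carrier, pos i v ∈ (S i).starting.carrier :=
    fun i hi v hv => hstart i hi ▸ Set.mem_image_of_mem _ hv
  have hmove' : ∀ i ≤ c.len, ∀ v ∈ (S 0).starting.carrier, pos (i + 1) v = (S i).move (pos i v) :=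
    fun i hi v hv => (hmove i _ (hmem i hi v hv)).symm
  have hback : ∀ i ≤ c.len, ∀ v ∈ (S 0).starting.carrier, back i (pos i v) = v := by
    intro i
    induction i with
    | zero => exact fun _ _ _ => rfl
    | succ i ih =>
      intro hi v hv
      change back i (f i (pos (i + 1) v)) = v
      rw [hmove' i (by omega) v hv, Swipe.move, hfadd, hfid i _ (hmem i (by omega) v hv),
        ih (by omega) v hv]
  refine ⟨⟨(S 0).starting.carrier, c.len + 1, Nat.succ_pos _, fun i => (S i).dir, pos,
    fun i x => back i (f i x), fun i _ => hpos_int i, fun i _ => (hback_int i).comp (hf i),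
    fun i _ x s => ?_, fun i hi v hv => ?_, fun i hi v hv => ?_⟩, ?_, rfl, fun i => ?_, fun i => ?_,
    fun i => ?_, fun i v hv => ?_⟩
  · rw [hfadd]
  · rw [hfid i _ (hmem i (by omega) v hv), hback i (by omega) v hv]
  · exact ⟨_, (S i).shift_nonneg _ (hmem i (by omega) v hv), hmove' i (by omega) v hv⟩
  · exact congrArg (fun T : Swipe ι => T.starting.carrier) (hS 0)
  · exact congrArg (fun T : Swipe ι => T.dir) (hS i).symm
  · exact ((hstart i (by omega)).trans
      (congrArg (fun T : Swipe ι => T.starting.carrier) (hS i))).symm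
  · have h := himage i
    rw [← hstart i (by omega), Set.image_image] at h
    rw [← hS]
    exact h.symm
  · rw [← hS]
    exact (hmove' i (by omega) v hv).symm

/-- The composition of the shears of the first `n` swipes. -/
theorem CompatibleSeq.exists_trajectory {ι : Type*} [DecidableEq ι] (c : CompatibleSeq ι) :
    ∃ M : ℕ → ((ι → ℝ) →ᵃ[ℝ] (ι → ℝ)), (∀ x, M 0 x = x) ∧
      ∀ (i : Fin (c.len + 1)) x, M (i + 1) x = (c.swipe i).move (M i x) := by
  let T : ℕ → ((ι → ℝ) →ᵃ[ℝ] (ι → ℝ)) := fun i =>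
    AffineMap.id ℝ _ + ((LinearMap.toSpanSingleton ℝ (ι → ℝ)
      (Pi.single (c.swipe ⟨min i c.len, by omega⟩).dir 1)).toAffineMap.comp
        (c.swipe ⟨min i c.len, by omega⟩).shift)
  have hT : ∀ (i : Fin (c.len + 1)) x, T i x = (c.swipe i).move x := by
    intro i x
    have hi : (⟨min (i : ℕ) c.len, by omega⟩ : Fin (c.len + 1)) = i :=
      Fin.ext (min_eq_left (by omega))
    change x + (c.swipe ⟨min (i : ℕ) c.len, _⟩).shift x •
      (Pi.single (c.swipe ⟨min (i : ℕ) c.len, _⟩).dir 1 : ι → ℝ) = _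
    rw [hi]
    rfl
  exact ⟨fun n => Nat.rec (AffineMap.id ℝ _) (fun i M => (T i).comp M) n, fun _ => rfl,
    fun i x => hT i _⟩

theorem exists_affineMap_rank (ι : Type*) [Fintype ι] : ∃ r : (ι → ℝ) →ᵃ[ℝ] ℝ, ∀ x, r x = rank x :=
  IntAffine.rank.exists_affineMap

/-- The sum of the ranks of start and end is an affine function of the start, so its value at the
vertices is its value on the simplex. Vertices may be missing from the turning set, hence the detour
through the shears `M`. -/
theorem Snake.IsSymmetric.follows {S : Snake ι} {P : Set (ι → ℝ)} (hS : S.IsSymmetric P)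
    {I : Itinerary τ ι} (h : S.seq.Follows I) {v : τ → ℝ} (hv : v ∈ I.domain) :
    rank (I.pos 0 v) + rank (I.pos I.len v) = polytopeRank P := by
  obtain ⟨M, hM0, hM⟩ := S.seq.exists_trajectory
  obtain ⟨r, hr⟩ := exists_affineMap_rank ι
  have hvert : ∀ x ∈ (S.seq.swipe 0).starting.vertices,
      (r + r.comp (M (S.seq.len + 1))) x = polytopeRank P := by
    intro x hx
    have := hS (fun i => M i x) (by simpa [hM0] using hx) fun i => by simpa using hM i x
    simpa [hr, hM0] using this
  have hpos : ∀ i ≤ S.seq.len + 1, M i (I.pos 0 v) = I.pos i v := by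
    intro i
    induction i with
    | zero => exact fun _ => hM0 _
    | succ i ih =>
      intro hi
      have h1 := hM ⟨i, hi⟩ (I.pos 0 v)
      have h2 := h.move_eq ⟨i, hi⟩ v hv
      dsimp only at h1 h2
      rw [h1, ih (by omega), h2]
  have hmem : I.pos 0 v ∈ (S.seq.swipe 0).starting.carrier := by
    rw [h.starting_eq]
    exact Set.mem_image_of_mem _ hv
  obtain ⟨w, hw, h1, h2⟩ := Finset.mem_convexHull'.1 hmem.1
  have h3 := affineMap_sum_smul (r + r.comp (M (S.seq.len + 1))) _ w h1
  rw [h2, Finset.sum_congr rfl fun x hx => by rw [hvert x hx], ← Finset.sum_smul, h1,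
    one_smul] at h3
  rw [h.len_eq, ← hpos _ le_rfl, ← hr, ← hr]
  exact h3

/-- An itinerary parametrised by the relative interior of a simplex gives a compatible sequence of
swipes. -/
theorem Itinerary.exists_compatibleSeq (I : Itinerary τ ι) {s : Finset (τ → ℝ)} (hne : s.Nonempty)
    (hs : AffineIndependent ℝ ((↑) : s → (τ → ℝ))) (hI : I.domain = openHull s) :
    ∃ c : CompatibleSeq ι, c.Follows I ∧ (∀ x ∈ (c.swipe 0).starting.vertices,
      ∃ p ∈ s, x = I.pos 0 p) ∧ ∀ i, ∀ p ∈ s, (c.swipe i).move (I.pos i p) = I.pos (i + 1) p := by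
  classical
  choose! g hg using fun i (hi : i ≤ I.len) => (I.pos_int i hi).exists_affineMap
  choose! q hq using fun i (hi : i < I.len) => (I.inv_int i hi).exists_affineMap
  have hleft : ∀ i ≤ I.len, ∃ k : (ι → ℝ) →ᵃ[ℝ] (τ → ℝ), ∀ p ∈ s, k (g i p) = p := by
    intro i hi
    obtain ⟨k, hk⟩ : ∃ k : (ι → ℝ) →ᵃ[ℝ] (τ → ℝ), ∀ v ∈ I.domain, k (g i v) = v := by
      rcases hi.lt_or_eq with hi' | rfl
      · exact ⟨q i, fun v hv => by rw [hg i hi, hq i hi', I.inv_pos i hi' v hv]⟩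
      -- No segment starts at the last turning point; the last segment, which ends there, supplies
      -- the inverse.
      · have hlen := I.len_pos
        have hi' : I.len - 1 < I.len := by omega
        refine ⟨q (I.len - 1), fun v hv => ?_⟩
        have h1 := (Itinerary.Seg.pos_right hi' hv).inv_eq hi' hv
        rw [Nat.sub_add_cancel hlen] at h1
        rw [hg _ hi, hq _ hi', h1]
    refine ⟨k, fun p hp => ?_⟩
    exact eq_of_eqOn_openHull (f := k.comp (g i)) (g := AffineMap.id ℝ _)
      (fun x hx => hk x (hI ▸ hx)) hp
  have hindep : ∀ i ≤ I.len, AffineIndependent ℝ ((↑) : ↥(s.image (g i)) → (ι → ℝ)) := by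
    intro i hi
    obtain ⟨k, hk⟩ := hleft i hi
    exact affineIndependent_image hs (g i) k hk
  have hinj : ∀ i ≤ I.len, Set.InjOn (g i) s := by
    intro i hi x hx y hy hxy
    obtain ⟨k, hk⟩ := hleft i hi
    rw [← hk x hx, hxy, hk y hy]
  let A : ∀ i ≤ I.len, PartialSimplex ι := fun i hi =>
    PartialSimplex.ofOpen (s.image (g i)) (hne.image _) (hindep i hi)
  have hA : ∀ i hi, (A i hi).carrier = I.pos i '' I.domain := by
    intro i hi
    rw [PartialSimplex.ofOpen_carrier, openHull_image _ (hinj i hi), hI, funext (hg i hi)]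
  obtain ⟨r, hr⟩ := exists_affineMap_rank ι
  let shift : ℕ → ((ι → ℝ) →ᵃ[ℝ] ℝ) := fun i => r.comp ((g (i + 1)).comp (q i)) -
    r.comp ((g i).comp (q i))
  have hshift : ∀ i < I.len, ∀ v ∈ I.domain,
      shift i (I.pos i v) = rank (I.pos (i + 1) v) - rank (I.pos i v) := by
    intro i hi v hv
    change r (g (i + 1) (q i (I.pos i v))) - r (g i (q i (I.pos i v))) = _
    rw [hr, hr, hq i hi, I.inv_pos i hi v hv, hg _ hi, hg _ hi.le]
  have hmove : ∀ i < I.len, ∀ v ∈ I.domain,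
      I.pos i v + shift i (I.pos i v) • (Pi.single (I.dir i) 1 : ι → ℝ) = I.pos (i + 1) v := by
    intro i hi v hv
    rw [hshift i hi v hv, ← Itinerary.pos_succ hi hv]
  -- The vertices need not belong to the domain; both sides are affine and agree on the open
  -- simplex, hence at its vertices.
  have hmove' : ∀ i < I.len, ∀ p ∈ s,
      I.pos i p + shift i (I.pos i p) • (Pi.single (I.dir i) 1 : ι → ℝ) = I.pos (i + 1) p := by
    intro i hi p hp
    have := eq_of_eqOn_openHull (f := g i + (LinearMap.toSpanSingleton ℝ (ι → ℝ)
      (Pi.single (I.dir i) 1)).toAffineMap.comp ((shift i).comp (g i))) (g := g (i + 1))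
      (fun x hx => ?_) hp
    · rw [← hg _ hi, ← this, ← hg i hi.le]
      rfl
    · rw [hg _ hi, ← hmove i hi x (hI ▸ hx), ← hg i hi.le]
      rfl
  let S : ∀ i < I.len, Swipe ι := fun i hi =>
    { dir := I.dir i
      starting := A i hi.le
      ending := A (i + 1) hi
      shift := shift i
      shift_nonneg := by
        rw [hA i hi.le]
        rintro _ ⟨v, hv, rfl⟩
        rw [hshift i hi v hv]
        exact sub_nonneg.2 (Itinerary.rank_pos_le_succ hi hv)
      bijOn := by
        rw [hA i hi.le, hA (i + 1) hi]
        refine ⟨?_, ?_, ?_⟩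
        · rintro _ ⟨v, hv, rfl⟩
          exact ⟨v, hv, (hmove i hi v hv).symm⟩
        · rintro _ ⟨v, hv, rfl⟩ _ ⟨w, hw, rfl⟩ h
          dsimp only at h
          rw [hmove i hi v hv, hmove i hi w hw] at h
          rw [← (Itinerary.Seg.pos_right hi hv).inv_eq hi hv, h,
            (Itinerary.Seg.pos_right hi hw).inv_eq hi hw]
        · rintro _ ⟨v, hv, rfl⟩
          exact ⟨_, ⟨v, hv, rfl⟩, hmove i hi v hv⟩ }
  -- A compatible sequence of length `n` has `n + 1` swipes.
  have hlen : I.len - 1 + 1 = I.len := Nat.sub_add_cancel I.len_pos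
  have hlt : ∀ i : Fin (I.len - 1 + 1), (i : ℕ) < I.len := fun i => by omega
  refine ⟨⟨I.len - 1, fun i => S i (hlt i), fun i => rfl⟩, ⟨hlen.symm, fun i => rfl,
    fun i => hA i (hlt i).le, fun i => hA (i + 1) (hlt i), fun i v hv => hmove i (hlt i) v hv⟩, ?_,
    fun i p hp => hmove' i (hlt i) p hp⟩
  intro x hx
  obtain ⟨p, hp, rfl⟩ := Finset.mem_image.1 (hx : x ∈ s.image (g 0))
  exact ⟨p, hp, hg 0 (Nat.zero_le _) p⟩

end Existence

/-! ### Additivity of the rank of a polytope. -/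

section PolytopeRank

variable {ι κ : Type*} [Fintype ι] [Fintype κ]

theorem IsPolytope.isBounded {P : Set (ι → ℝ)} (hP : IsPolytope P) : Bornology.IsBounded P := by
  obtain ⟨-, F, hF, rfl⟩ := hP
  refine (Bornology.isBounded_biUnion hF).2 fun s _ => ?_
  exact (isBounded_convexHull.2 s.finite_toSet.isBounded).subset (openHull_subset_convexHull s)

theorem IsPolytope.isBounded_rank {P : Set (ι → ℝ)} (hP : IsPolytope P) :
    Bornology.IsBounded (rank '' P) :=
  hP.isBounded.image_continuous IntAffine.rank.continuous

open Pointwise in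
-- The ranks on the product form the Minkowski sum of the two sets of ranks. Supremum and infimum
-- are additive since these sets are nonempty and bounded.
theorem polytopeRank_product {P : Set (ι → ℝ)} {Q : Set (κ → ℝ)} (hP : IsPolytope P)
    (hQ : IsPolytope Q) : polytopeRank (product P Q) = polytopeRank P + polytopeRank Q := by
  have himage : rank '' product P Q = rank '' P + rank '' Q := by
    ext r
    rw [Set.mem_add]
    constructor
    · rintro ⟨z, hz, rfl⟩
      refine ⟨_, ⟨_, hz.1, rfl⟩, _, ⟨_, hz.2, rfl⟩, ?_⟩
      simp [rank]
    · rintro ⟨_, ⟨x, hx, rfl⟩, _, ⟨y, hy, rfl⟩, rfl⟩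
      exact ⟨Sum.elim x y, ⟨hx, hy⟩, rank_sumElim x y⟩
  have hPn := hP.1.image rank
  have hQn := hQ.1.image rank
  have hPb := isBounded_iff_bddBelow_bddAbove.1 hP.isBounded_rank
  have hQb := isBounded_iff_bddBelow_bddAbove.1 hQ.isBounded_rank
  rw [polytopeRank, himage, csSup_add hPn hPb.2 hQn hQb.2, csInf_add hPn hPb.1 hQn hQb.1,
    polytopeRank, polytopeRank]
  ring

end PolytopeRank

/-! ### Decompositions as sweeps, and back. -/

section Decomposition

variable {τ ι : Type*} [Fintype τ] [Fintype ι] [DecidableEq ι]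

/-- The proposition `fake` records the kind of snake, so that both cases of the theorem share one
argument. -/
theorem Snake.carrier_eq_of_follows {S : Snake ι} {I : Itinerary τ ι} (h : S.seq.Follows I)
    {fake : Prop} (hS : S.IsReal ∧ ¬ fake ∨ S.IsFake ∧ fake) :
    S.carrier = {x | ∃ v ∈ I.domain, I.Inside fake v x} ∧
      ∀ v ∈ I.domain, ∀ w ∈ I.domain, ∀ x, I.Inside fake v x → I.Inside fake w x → v = w := by
  cases S with
  | real c hc =>
    obtain rfl : fake = False := eq_false (hS.elim And.right fun h => h.1.elim)
    exact ⟨h.iUnion_swipe, fun v hv w hw x => h.param_unique_of_real hc hv hw⟩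
  | fake c hc =>
    obtain rfl : fake = True := eq_true (hS.elim (fun h => h.1.elim) And.right)
    exact ⟨h.iUnion_trimmed, fun v hv w hw x => h.param_unique_of_fake hc hv hw⟩

/-- A decomposition into snakes of one kind with the strong hyperplane condition, in terms of
itineraries. -/
theorem GeometricSCD.StrongHyperplaneCondition.exists_isSweep {P : Set (ι → ℝ)}
    {D : GeometricSCD P} (hD : D.StrongHyperplaneCondition) {fake : Prop}
    (hkind : D.AllReal ∧ ¬ fake ∨ D.AllFake ∧ fake) :
    ∃ I : Fin D.size → Itinerary ι ι, IsSweep fake P (polytopeRank P) I ∧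
      (∀ n, Bornology.IsBounded (I n).domain) ∧ ∀ n, SignDetermined (I n).domain := by
  choose I hI hfollows using fun n => (D.snake n).seq.exists_follows (hD n)
  have key := fun n => Snake.carrier_eq_of_follows (hfollows n) (fake := fake)
    (hkind.imp (fun h => ⟨h.1 n, h.2⟩) fun h => ⟨h.1 n, h.2⟩)
  have hcar : ∀ n x, x ∈ (D.snake n).carrier ↔ ∃ v ∈ (I n).domain, (I n).Inside fake v x :=
    fun n x => by rw [(key n).1]; rfl
  refine ⟨I, ⟨fun n v hv x hx => ?_, fun x hx => ?_, fun n m v hv w hw x hxv hxw => ?_,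
    fun n v hv => (D.symmetric n).follows (hfollows n) hv⟩, fun n => ?_, fun n => ?_⟩
  · rw [← D.union_eq]
    exact Set.mem_iUnion.2 ⟨n, (hcar n x).2 ⟨v, hv, hx⟩⟩
  · rw [← D.union_eq] at hx
    obtain ⟨n, hn⟩ := Set.mem_iUnion.1 hx
    exact ⟨n, (hcar n x).1 hn⟩
  · obtain rfl : n = m := by
      by_contra hne
      exact Set.disjoint_left.1 (D.disjoint n m hne) ((hcar n x).2 ⟨v, hv, hxv⟩)
        ((hcar m x).2 ⟨w, hw, hxw⟩)
    exact ⟨rfl, (key n).2 v hv w hw x hxv hxw⟩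
  · rw [hI]
    exact PartialSimplex.isBounded _
  · rw [hI]
    exact PartialSimplex.signDetermined _

/-- An itinerary parametrised by the relative interior of a simplex gives a snake. -/
theorem Itinerary.exists_snake (I : Itinerary τ ι) {fake : Prop} {s : Finset (τ → ℝ)}
    (hne : s.Nonempty) (hs : AffineIndependent ℝ ((↑) : s → (τ → ℝ))) (hI : I.domain = openHull s)
    (hu : ∀ v ∈ I.domain, ∀ w ∈ I.domain, ∀ x, I.Inside fake v x → I.Inside fake w x → v = w)
    {P : Set (ι → ℝ)}
    (hR : ∀ v ∈ I.domain, rank (I.pos 0 v) + rank (I.pos I.len v) = polytopeRank P) :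
    ∃ S : Snake ι, S.seq.Follows I ∧ S.IsSymmetric P ∧
      S.carrier = {x | ∃ v ∈ I.domain, I.Inside fake v x} := by
  obtain ⟨c, hc, hvert, hmove⟩ := I.exists_compatibleSeq hne hs hI
  obtain ⟨S, rfl, hS⟩ : ∃ S : Snake ι, S.seq = c ∧
      S.carrier = {x | ∃ v ∈ I.domain, I.Inside fake v x} := by
    by_cases hf : fake
    · obtain rfl : fake = True := eq_true hf
      exact ⟨Snake.fake c (hc.fakeCondition hu), rfl, hc.iUnion_trimmed⟩
    · obtain rfl : fake = False := eq_false hf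
      exact ⟨Snake.real c (hc.realCondition hu), rfl, hc.iUnion_swipe⟩
  refine ⟨S, hc, fun p h0 hp => ?_, hS⟩
  obtain ⟨w, hw, hw0⟩ := hvert _ h0
  have hpos : ∀ i, p i = I.pos i w := by
    intro i
    induction i using Fin.induction with
    | zero => exact hw0
    | succ i ih =>
      rw [hp, ih]
      exact hmove i w hw
  obtain ⟨r, hr⟩ := (((I.pos_int 0 (Nat.zero_le _)).rank).add
    (I.pos_int _ le_rfl).rank).exists_affineMap
  -- Symmetry is known for the paths in the open simplex and passes to the vertices because the rank
  -- sum is affine.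
  have h1 := eq_of_eqOn_openHull (f := r) (g := AffineMap.const ℝ _ (polytopeRank P))
    (fun x hx => (hr x).trans (hR x (hI ▸ hx))) hw
  rw [hr, hc.len_eq] at h1
  rw [hpos, hpos]
  exact h1

theorem IsSweep.exists_geometricSCD {P : Set (ι → ℝ)} {fake : Prop} {N : ℕ}
    {I : Fin N → Itinerary τ ι} (h : IsSweep fake P (polytopeRank P) I)
    (hI : ∀ n, ∃ s : Finset (τ → ℝ), s.Nonempty ∧
      AffineIndependent ℝ ((↑) : s → (τ → ℝ)) ∧ (I n).domain = openHull s) :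
    ∃ D : GeometricSCD P, D.StrongHyperplaneCondition := by
  choose s hne hs hdom using hI
  choose S hfollows hsymm hcar using fun n => (I n).exists_snake (fake := fake) (hne n) (hs n)
    (hdom n) (fun v hv w hw x hxv hxw => (h.unique n n v hv w hw x hxv hxw).2) (h.symmetric n)
  refine ⟨⟨N, S, fun n m hnm => ?_, ?_, hsymm⟩, fun n i => (hfollows n).inIntegralHyperplane i⟩
  · rw [hcar, hcar, Set.disjoint_left]
    rintro x ⟨v, hv, hxv⟩ ⟨w, hw, hxw⟩
    exact hnm (h.unique n m v hv w hw x hxv hxw).1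
  · ext x
    simp only [hcar, Set.mem_iUnion]
    constructor
    · rintro ⟨n, v, hv, hx⟩
      exact h.mem n v hv x hx
    · exact fun hx => h.exists_mem x hx

end Decomposition

end SnakeDecomposition

/-! ### The product theorem. -/

theorem theorem6p8 {ι κ : Type*} [Fintype ι] [DecidableEq ι] [Fintype κ] [DecidableEq κ]
    (P : Set (ι → ℝ)) (Q : Set (κ → ℝ))
    (hP : SnakeDecomposition.IsPolytope P) (hQ : SnakeDecomposition.IsPolytope Q)
    (D : SnakeDecomposition.GeometricSCD P) (E : SnakeDecomposition.GeometricSCD Q)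
    (hD : D.StrongHyperplaneCondition) (hE : E.StrongHyperplaneCondition)
    (hkind : (D.AllReal ∧ E.AllReal) ∨ (D.AllFake ∧ E.AllFake)) :
    ∃ F : SnakeDecomposition.GeometricSCD (SnakeDecomposition.product P Q),
      F.StrongHyperplaneCondition := by
  obtain ⟨fake, hD', hE'⟩ : ∃ fake : Prop, (D.AllReal ∧ ¬ fake ∨ D.AllFake ∧ fake) ∧
      (E.AllReal ∧ ¬ fake ∨ E.AllFake ∧ fake) := by
    rcases hkind with ⟨h1, h2⟩ | ⟨h1, h2⟩
    · exact ⟨False, Or.inl ⟨h1, not_false⟩, Or.inl ⟨h2, not_false⟩⟩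
    · exact ⟨True, Or.inr ⟨h1, trivial⟩, Or.inr ⟨h2, trivial⟩⟩
  obtain ⟨I, hI, hIb, hIs⟩ := hD.exists_isSweep hD'
  obtain ⟨J, hJ, hJb, hJs⟩ := hE.exists_isSweep hE'
  obtain ⟨N, K, hK, hdom⟩ := hI.exists_product hJ hIb hJb hIs hJs
  rw [← SnakeDecomposition.polytopeRank_product hP hQ] at hK
  exact hK.exists_geometricSCD hdom
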